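/- Let $I\subseteq(0,\infty)$ be an open interval and let $\psi:I\to\mathbb R$ be a twice continuously differentiable central potential. For $\Lambda\ge 0$ put $\psi_e(r)=\frac{\Lambda^2}{2r^2}+\psi(r)$. A (bounded, radially periodic, non-circular) orbit of energy $\xi$ and angular momentum $\Lambda\ge 0$ per unit mass is given by radii $r_P<r_A$ with $[r_P,r_A]\subseteq I$ such that $\psi_e(r_P)=\psi_e(r_A)=\xi$, $\psi_e<\xi$ on $(r_P,r_A)$, and $\psi_e'(r_P)\neq0$, $\psi_e'(r_A)\ne 0$. Its radial period is $$T=2\int_{r_P}^{r_A}\frac{\mathrm dr}{\sqrt{2\xi-2\psi(r)-\Lambda^2/r^2}} .$$ The potential $\psi$ is called isochrone if there is a function of $\xi$ alone which gives the radial period $T$ of every such orbit. A parabola is a set $\{(x,y)\in\mathbb R^2:(ax+by)^2+cx+dy+e=0\}$ with real coefficients such that $ad-bc\neq0$. Suppose that $\psi$ is isochrone. Let $V\subseteq I$ be the set of the radii visited by orbits, that is, the union of the intervals $[r_P,r_A]$ of all orbits. Then, in Hénon's variables $x=2r^2$, $Y(x)=2r^2\psi(r)$, the curve $y=Y(x)$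 over the radii in $V$ is an arc of a parabola: $V$ is an interval (possibly empty), and there is one parabola that contains all the points $(2r^2,\,2r^2\psi(r))$ with $r\in V$. If moreover $\psi$ is non-decreasing (attractive) and has at least one orbit, then $V=I$, so that the whole curve $y=Y(x)$ is an arc of a parabola. -/

import Mathlib

open Set

/-- The effective potential `ψ_e(r) = Λ² / (2 r²) + ψ(r)` of a particle with angular momentum
`Λ` per unit mass in the central potential `ψ`. -/
noncomputable def effectivePotential (ψ : ℝ → ℝ) (Λ r : ℝ) : ℝ :=
  Λ ^ 2 / (2 * r ^ 2) + ψ r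

/-- `[rP, rA]` is the radial range of a bounded, radially periodic, non-circular orbit of energy
`ξ` and angular momentum `Λ` (per unit mass) in the potential `ψ` defined on `I`: the radial
velocity vanishes at `rP` and `rA`, the radial kinetic energy `ξ - ψ_e` is positive in between,
and the effective force does not vanish at `rP` and `rA`, so that these are genuine turning points
(if it vanished, `rP` or `rA` would be the radius of a circular orbit of the same energy and
angular momentum, approached asymptotically and never reached). -/
structure IsRadialOrbit (ψ : ℝ → ℝ) (I : Set ℝ) (ξ Λ rP rA : ℝ) : Prop where
  momentum_nonneg : 0 ≤ Λ
  noncircular : rP < rA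
  mem_domain : Icc rP rA ⊆ I
  periapsis : effectivePotential ψ Λ rP = ξ
  apoapsis : effectivePotential ψ Λ rA = ξ
  below : ∀ r ∈ Ioo rP rA, effectivePotential ψ Λ r < ξ
  turning_periapsis : deriv (effectivePotential ψ Λ) rP ≠ 0
  turning_apoapsis : deriv (effectivePotential ψ Λ) rA ≠ 0

/-- The radial period `T = 2 ∫_{rP}^{rA} dr / √(2ξ - 2ψ(r) - Λ²/r²)`. -/
noncomputable def radialPeriod (ψ : ℝ → ℝ) (ξ Λ rP rA : ℝ) : ℝ :=
  2 * ∫ r in rP..rA, 1 / √(2 * ξ - 2 * ψ r - Λ ^ 2 / r ^ 2)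

/-- `ψ` is isochrone on `I`: the radial period of its periodic orbits is a function of the energy
alone. -/
def IsIsochrone (ψ : ℝ → ℝ) (I : Set ℝ) : Prop :=
  ∃ T : ℝ → ℝ, ∀ ξ Λ rP rA : ℝ, IsRadialOrbit ψ I ξ Λ rP rA → radialPeriod ψ ξ Λ rP rA = T ξ

/-- The radii that are visited by some periodic non-circular orbit. -/
def visitedRadii (ψ : ℝ → ℝ) (I : Set ℝ) : Set ℝ :=
  {r | ∃ ξ Λ rP rA : ℝ, IsRadialOrbit ψ I ξ Λ rP rA ∧ r ∈ Icc rP rA}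

/-- The part of the curve `y = Y(x)`, in Hénon's variables `x = 2r²` and `Y = 2r²ψ(r)`, that lies
over the radii `r ∈ S`. -/
def henonCurve (ψ : ℝ → ℝ) (S : Set ℝ) : Set (ℝ × ℝ) :=
  (fun r : ℝ => (2 * r ^ 2, 2 * r ^ 2 * ψ r)) '' S

/-- A parabola in the plane, with arbitrary axis: `(a x + b y)² + c x + d y + e = 0` with
`a d - b c ≠ 0`. -/
def IsParabola (P : Set (ℝ × ℝ)) : Prop :=
  ∃ a b c d e : ℝ, a * d - b * c ≠ 0 ∧
    P = {p : ℝ × ℝ | (a * p.1 + b * p.2) ^ 2 + c * p.1 + d * p.2 + e = 0}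

/-! With Y(x) = xψ in the variable x = 2r², one has ξx − Y(x) − Λ² = x(ξ − ψ_e). So an orbit of
energy ξ and momentum Λ is a bump of the gap ξx − Y(x) over the level Λ², that is, a transversal
chord of slope ξ above the curve. The substitution turns the radial period into half of ∫ dx/√(gap −
Λ²), which isochrony makes depend on the slope only.

Constancy of this integral is first used qualitatively. Bumps close to a quadratic contact have
logarithmically divergent integrals (`false_of_quadratic_contact`), so a bump contains no valley,
and by Sard almost every higher level cuts out exactly one smaller bump.

Abel's integral equation then gives the area G(ξ, μ) of the gap above the level μ as A(ξ)(N(ξ) −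
μ)^(3/2), with N the maximum (`IsBump.area`). Hence G^(2/3) is affine in μ. If [c, d] is the chord,
then ∂G/∂μ = −(d − c) and ∂G/∂ξ = (d² − c²)/2. So widths are proportional to √(N − μ) and midpoints
are affine in μ (`IsBump.chord_law`), which parametrizes the arc quadratically.

To join the arcs, a chord is rotated about its left end. It could stop reaching further right only
by becoming tangent at its right end, which is again a forbidden contact. Thus two orbit ranges
always lie in a single larger one, and since an arc determines its parabola, all parabolas coincide
(`exists_common_parabola`). Rotation about the right end could produce a negative level;
monotonicity of ψ = Y/x rules this out, and then every radius is visited. -/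

/-! ### Bumps, their period integrals, and forbidden critical points. -/

section Bumps

open MeasureTheory Filter Topology

/-- `[c, d] ⊆ S` is the closure of a component of `{F > μ}` with transversal end points. -/
structure IsBump (F : ℝ → ℝ) (S : Set ℝ) (μ c d : ℝ) : Prop where
  lt : c < d
  subset : Icc c d ⊆ S
  left : F c = μ
  right : F d = μ
  above : ∀ x ∈ Ioo c d, μ < F x
  deriv_left : deriv F c ≠ 0
  deriv_right : deriv F d ≠ 0

/-- The period integral of all bumps of `F` over a nonnegative level is `τ`. -/
def HasConstantPeriod (F : ℝ → ℝ) (S : Set ℝ) (τ : ℝ) : Prop :=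
  ∀ μ c d : ℝ, 0 ≤ μ → IsBump F S μ c d → ∫ x in c..d, 1 / √(F x - μ) = τ

theorem deriv_comp_neg_at (F : ℝ → ℝ) (x : ℝ) :
    deriv (fun y => F (-y)) x = -deriv F (-x) := deriv_comp_neg F x

theorem IsBump.reflect {F : ℝ → ℝ} {S : Set ℝ} {μ c d : ℝ} (h : IsBump F S μ c d) :
    IsBump (fun x => F (-x)) (Neg.neg ⁻¹' S) μ (-d) (-c) where
  lt := neg_lt_neg h.lt
  subset := fun x hx => h.subset ⟨by linarith [hx.2], by linarith [hx.1]⟩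
  left := by simpa using h.right
  right := by simpa using h.left
  above := fun x hx => h.above _ ⟨by linarith [hx.2], by linarith [hx.1]⟩
  deriv_left := by simpa [deriv_comp_neg_at] using h.deriv_right
  deriv_right := by simpa [deriv_comp_neg_at] using h.deriv_left

theorem HasConstantPeriod.reflect {F : ℝ → ℝ} {S : Set ℝ} {τ : ℝ} (h : HasConstantPeriod F S τ) :
    HasConstantPeriod (fun x => F (-x)) (Neg.neg ⁻¹' S) τ := by
  intro μ c d hμ hb
  have h1 := hb.reflect
  have h2 := h μ (-d) (-c) hμ (by simpa [preimage_preimage] using h1)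
  rw [← h2]
  exact intervalIntegral.integral_comp_neg (fun x => 1 / √(F x - μ))

theorem ContDiffOn.reflect {F : ℝ → ℝ} {S : Set ℝ} {n : WithTop ℕ∞} (h : ContDiffOn ℝ n F S) :
    ContDiffOn ℝ n (fun x => F (-x)) (Neg.neg ⁻¹' S) :=
  h.comp contDiff_neg.contDiffOn (fun _ hx => hx)

theorem IsOpen.reflect {S : Set ℝ} (h : IsOpen S) : IsOpen (Neg.neg ⁻¹' S) :=
  h.preimage continuous_neg

theorem ContDiffOn.differentiableAt_of_isOpen {F : ℝ → ℝ} {S : Set ℝ} (hF : ContDiffOn ℝ 2 F S)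
    (hS : IsOpen S) {x : ℝ} (hx : x ∈ S) : DifferentiableAt ℝ F x :=
  (hF.differentiableOn (by norm_num)).differentiableAt (hS.mem_nhds hx)

theorem deriv_nonneg_of_above {F : ℝ → ℝ} {c d : ℝ} (hcd : c < d) (hF : DifferentiableAt ℝ F c)
    (h : ∀ x ∈ Ioo c d, F c ≤ F x) : 0 ≤ deriv F c := by
  have h1 : Tendsto (slope F c) (𝓝[>] c) (𝓝 (deriv F c)) :=
    (hasDerivAt_iff_tendsto_slope.1 hF.hasDerivAt).mono_left
      (nhdsWithin_mono _ (fun x hx => ne_of_gt hx))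
  refine ge_of_tendsto h1 ?_
  filter_upwards [Ioo_mem_nhdsGT hcd] with x hx
  rw [slope_def_field]
  exact div_nonneg (by linarith [h x hx]) (by linarith [hx.1])

/-- A positive slope at `c` bounds F(x) − F(c) below by a multiple of x − c, so (x − c)^(-1/2)
dominates. This is where transversality of the end points matters. -/
theorem integrableOn_inv_sqrt_left {F : ℝ → ℝ} {c d : ℝ} (hcd : c < d)
    (hc : ContinuousOn F (Icc c d)) (hF : DifferentiableAt ℝ F c) (hF' : 0 < deriv F c) :
    ∃ e ∈ Ioo c d, IntegrableOn (fun x => 1 / √(F x - F c)) (Ioo c e) := by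
  have h1 : Tendsto (slope F c) (𝓝[>] c) (𝓝 (deriv F c)) :=
    (hasDerivAt_iff_tendsto_slope.1 hF.hasDerivAt).mono_left
      (nhdsWithin_mono _ (fun x hx => ne_of_gt hx))
  have h2 : ∀ᶠ x in 𝓝[>] c, deriv F c / 2 < slope F c x :=
    h1.eventually (lt_mem_nhds (by linarith))
  obtain ⟨e', he', hs⟩ := (mem_nhdsGT_iff_exists_Ioo_subset).1 h2
  have he'c : c < e' := he'
  obtain ⟨e, he1, he2⟩ := exists_between (lt_min he'c hcd)
  have hed : e < d := he2.trans_le (min_le_right _ _)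
  have hee : e < e' := he2.trans_le (min_le_left _ _)
  refine ⟨e, ⟨he1, hed⟩, ?_⟩
  set k := deriv F c / 2
  have hk : 0 < k := by simp only [k]; linarith
  have hI : IntegrableOn (fun x => (√k)⁻¹ * (x - c) ^ (-(1/2) : ℝ)) (Ioo c e) := by
    have h3 : IntervalIntegrable (fun x : ℝ => (x - c) ^ (-(1/2) : ℝ)) volume c e := by
      have := (intervalIntegral.intervalIntegrable_rpow' (a := c - c) (b := e - c)
        (r := (-(1/2) : ℝ)) (by norm_num)).comp_sub_right c
      simpa using this
    have h4 := (intervalIntegrable_iff_integrableOn_Ioc_of_le he1.le).1 h3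
    exact (h4.mono_set Ioo_subset_Ioc_self).const_mul _
  refine Integrable.mono' hI ?_ ?_
  · have hm : AEMeasurable F (volume.restrict (Ioo c e)) :=
      ((hc.mono (Ioo_subset_Icc_self.trans (Icc_subset_Icc_right hed.le))).aemeasurable
        measurableSet_Ioo)
    exact (((hm.sub_const _).sqrt).const_div 1).aestronglyMeasurable
  · refine (ae_restrict_iff' measurableSet_Ioo).2 (Eventually.of_forall fun x hx => ?_)
    have hxc : 0 < x - c := by linarith [hx.1]
    have h5 : k < slope F c x := hs ⟨hx.1, hx.2.trans hee⟩
    rw [slope_def_field, lt_div_iff₀ hxc] at h5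
    rw [Real.norm_of_nonneg (by positivity), Real.rpow_neg hxc.le, ← Real.sqrt_eq_rpow,
      ← mul_inv, ← Real.sqrt_mul hk.le, one_div]
    exact inv_anti₀ (Real.sqrt_pos.2 (by positivity)) (Real.sqrt_le_sqrt h5.le)

theorem IsBump.deriv_left_pos {F : ℝ → ℝ} {S : Set ℝ} {μ c d : ℝ} (h : IsBump F S μ c d)
    (hS : IsOpen S) (hF : ContDiffOn ℝ 2 F S) : 0 < deriv F c :=
  lt_of_le_of_ne (deriv_nonneg_of_above h.lt
    (hF.differentiableAt_of_isOpen hS (h.subset (left_mem_Icc.2 h.lt.le)))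
    fun x hx => by rw [h.left]; exact (h.above x hx).le) h.deriv_left.symm

theorem IsBump.exists_integrableOn_left {F : ℝ → ℝ} {S : Set ℝ} {μ c d : ℝ}
    (h : IsBump F S μ c d) (hS : IsOpen S) (hF : ContDiffOn ℝ 2 F S) :
    ∃ e ∈ Ioo c d, IntegrableOn (fun x => 1 / √(F x - μ)) (Ioo c e) := by
  have := integrableOn_inv_sqrt_left h.lt (hF.continuousOn.mono h.subset)
    (hF.differentiableAt_of_isOpen hS (h.subset (left_mem_Icc.2 h.lt.le))) (h.deriv_left_pos hS hF)
  rwa [h.left] at this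

theorem IsBump.integrableOn {F : ℝ → ℝ} {S : Set ℝ} {μ c d : ℝ} (h : IsBump F S μ c d)
    (hS : IsOpen S) (hF : ContDiffOn ℝ 2 F S) :
    IntegrableOn (fun x => 1 / √(F x - μ)) (Ioo c d) := by
  obtain ⟨e, he, hi⟩ := h.exists_integrableOn_left hS hF
  obtain ⟨e', he', hi'⟩ := h.reflect.exists_integrableOn_left hS.reflect hF.reflect
  have hi2 : IntegrableOn (fun x => 1 / √(F x - μ)) (Ioo (-e') d) := by
    have h1 := (intervalIntegrable_iff_integrableOn_Ioo_of_le he'.1.le).2 hi'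
    have h2 := ((IntervalIntegrable.iff_comp_neg (f := fun x => 1 / √(F (-x) - μ))).1 h1)
    simp only [neg_neg] at h2
    exact (intervalIntegrable_iff_integrableOn_Ioo_of_le (by linarith [he'.1])).1 h2.symm
  have hi3 : IntegrableOn (fun x => 1 / √(F x - μ)) (Icc e (-e')) := by
    refine ContinuousOn.integrableOn_Icc ?_
    have hsub : Icc e (-e') ⊆ Ioo c d := fun x hx =>
      ⟨he.1.trans_le hx.1, hx.2.trans_lt (by linarith [he'.1])⟩
    refine continuousOn_const.div
      (((hF.continuousOn.mono (hsub.trans (Ioo_subset_Icc_self.trans h.subset))).sub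
        continuousOn_const).sqrt) fun x hx => ?_
    exact (Real.sqrt_pos.2 (by linarith [h.above x (hsub hx)])).ne'
  refine ((hi.union hi3).union hi2).mono_set fun x hx => ?_
  rcases lt_or_ge x e with h1 | h1
  · exact Or.inl (Or.inl ⟨hx.1, h1⟩)
  · rcases le_or_gt x (-e') with h2 | h2
    · exact Or.inl (Or.inr ⟨h1, h2⟩)
    · exact Or.inr ⟨h2, hx.2⟩

theorem IsBump.setIntegral_eq {F : ℝ → ℝ} {S : Set ℝ} {μ c d τ : ℝ} (h : IsBump F S μ c d)
    (hμ : 0 ≤ μ) (hT : HasConstantPeriod F S τ) :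
    ∫ x in Ioo c d, 1 / √(F x - μ) = τ := by
  rw [← hT μ c d hμ h, intervalIntegral.integral_of_le h.lt.le, integral_Ioc_eq_integral_Ioo]

theorem IsBump.lintegral_eq {F : ℝ → ℝ} {S : Set ℝ} {μ c d τ : ℝ} (h : IsBump F S μ c d)
    (hμ : 0 ≤ μ) (hT : HasConstantPeriod F S τ) (hS : IsOpen S) (hF : ContDiffOn ℝ 2 F S) :
    ∫⁻ x in Ioo c d, ENNReal.ofReal (1 / √(F x - μ)) = ENNReal.ofReal τ := by
  rw [← h.setIntegral_eq hμ hT]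
  exact (ofReal_integral_eq_lintegral_ofReal (h.integrableOn hS hF)
    (Eventually.of_forall fun x => by positivity)).symm

theorem exists_left_end {F : ℝ → ℝ} {a z μ : ℝ} (haz : a ≤ z) (hc : ContinuousOn F (Icc a z))
    (ha : F a ≤ μ) (hz : μ < F z) :
    ∃ c, a ≤ c ∧ c < z ∧ F c = μ ∧ ∀ x ∈ Ioc c z, μ < F x := by
  have hcl : IsCompact {x ∈ Icc a z | F x ≤ μ} :=
    isCompact_Icc.of_isClosed_subset
      (hc.preimage_isClosed_of_isClosed isClosed_Icc isClosed_Iic) (fun x hx => hx.1)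
  obtain ⟨c, ⟨hc1, hc2⟩, hc3⟩ := hcl.exists_isGreatest ⟨a, left_mem_Icc.2 haz, ha⟩
  have hcz : c < z := lt_of_le_of_ne hc1.2 (by rintro rfl; linarith)
  have habove : ∀ x ∈ Ioc c z, μ < F x := fun x hx => by
    by_contra hcon
    exact absurd (hc3 ⟨⟨hc1.1.trans hx.1.le, hx.2⟩, not_lt.1 hcon⟩) (not_le.2 hx.1)
  refine ⟨c, hc1.1, hcz, ?_, habove⟩
  obtain ⟨y, hy, hy2⟩ := intermediate_value_Icc hcz.le (hc.mono (Icc_subset_Icc_left hc1.1))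
    (⟨hc2, hz.le⟩ : μ ∈ Icc (F c) (F z))
  rcases hy.1.eq_or_lt with h | h
  · rw [h]; exact hy2
  · exact absurd (habove y ⟨h, hy.2⟩) (by rw [hy2]; exact lt_irrefl _)

theorem exists_right_end {F : ℝ → ℝ} {q b μ : ℝ} (hqb : q ≤ b) (hc : ContinuousOn F (Icc q b))
    (hb : F b ≤ μ) (hq : μ < F q) :
    ∃ d, q < d ∧ d ≤ b ∧ F d = μ ∧ ∀ x ∈ Ico q d, μ < F x := by
  obtain ⟨c, h1, h2, h3, h4⟩ := exists_left_end (F := fun x => F (-x)) (a := -b) (z := -q)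
    (neg_le_neg hqb)
    (hc.comp continuous_neg.continuousOn fun x hx => ⟨by linarith [hx.2], by linarith [hx.1]⟩)
    (by simpa using hb) (by simpa using hq)
  refine ⟨-c, by linarith, by linarith, h3, fun x hx => ?_⟩
  simpa using h4 (-x) ⟨by linarith [hx.2], by linarith [hx.1]⟩

/-- The component of a superlevel set that contains `[z, q]`. -/
theorem exists_component {F : ℝ → ℝ} {a b z q μ : ℝ} (haz : a ≤ z) (hzq : z ≤ q) (hqb : q ≤ b)
    (hc : ContinuousOn F (Icc a b)) (ha : F a ≤ μ) (hb : F b ≤ μ)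
    (hK : ∀ x ∈ Icc z q, μ < F x) :
    ∃ c d, a ≤ c ∧ c < z ∧ q < d ∧ d ≤ b ∧ F c = μ ∧ F d = μ ∧ ∀ x ∈ Ioo c d, μ < F x := by
  obtain ⟨c, h1, h2, h3, h4⟩ := exists_left_end haz
    (hc.mono (Icc_subset_Icc_right (hzq.trans hqb))) ha (hK z (left_mem_Icc.2 hzq))
  obtain ⟨d, g1, g2, g3, g4⟩ := exists_right_end hqb
    (hc.mono (Icc_subset_Icc_left (haz.trans hzq))) hb (hK q (right_mem_Icc.2 hzq))
  refine ⟨c, d, h1, h2, g1, g2, h3, g3, fun x hx => ?_⟩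
  rcases le_or_gt x z with h | h
  · exact h4 x ⟨hx.1, h⟩
  · rcases le_or_gt x q with h' | h'
    · exact hK x ⟨h.le, h'⟩
    · exact g4 x ⟨h'.le, hx.2⟩

/-- Almost every level is regular. -/
theorem ae_regular_value {F : ℝ → ℝ} {S : Set ℝ} (hF : ∀ x ∈ S, DifferentiableAt ℝ F x) :
    ∀ᵐ μ : ℝ, ∀ x ∈ S, F x = μ → deriv F x ≠ 0 := by
  have h0 : volume (F '' {x ∈ S | deriv F x = 0}) = 0 := by
    refine addHaar_image_eq_zero_of_det_fderivWithin_eq_zero volume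
      (f' := fun x => ContinuousLinearMap.toSpanSingleton ℝ (deriv F x)) (fun x hx => ?_)
      (fun x hx => ?_)
    · exact (hF x hx.1).hasDerivAt.hasFDerivAt.hasFDerivWithinAt
    · rw [hx.2]
      simp [ContinuousLinearMap.det]
  have h1 : ∀ᵐ μ : ℝ, μ ∉ F '' {x ∈ S | deriv F x = 0} := measure_eq_zero_iff_ae_notMem.1 h0
  filter_upwards [h1] with μ hμ x hx hxμ hd
  exact hμ ⟨x, ⟨hx, hd⟩, hxμ⟩

theorem exists_mem_Ioo_of_ae {p : ℝ → Prop} (hp : ∀ᵐ μ : ℝ, p μ) {s t : ℝ} (hst : s < t) :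
    ∃ μ ∈ Ioo s t, p μ := by
  have : (volume.restrict (Ioo s t)) ≠ 0 := by
    rw [Ne, Measure.restrict_eq_zero, Real.volume_Ioo]
    simpa using hst
  have : (ae (volume.restrict (Ioo s t))).NeBot := ae_neBot.2 this
  obtain ⟨μ, h1, h2⟩ :=
    ((ae_restrict_of_ae hp).and
      (ae_restrict_mem (μ := volume) (measurableSet_Ioo (a := s) (b := t)))).exists
  exact ⟨μ, h2, h1⟩

/-- Bumps that come arbitrarily close to a quadratic contact have unbounded periods. -/
theorem false_of_quadratic_contact {F : ℝ → ℝ} {S : Set ℝ} {τ z δ C : ℝ} (hS : IsOpen S)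
    (hF : ContDiffOn ℝ 2 F S) (hT : HasConstantPeriod F S τ) (hδ : 0 < δ) (hC : 0 < C)
    (h : ∀ η ∈ Ioo 0 δ, ∃ μ c d, 0 ≤ μ ∧ IsBump F S μ c d ∧ Ioo (z + η) (z + δ) ⊆ Ioo c d ∧
      ∀ x ∈ Ioo (z + η) (z + δ), F x - μ ≤ C * (x - z) ^ 2) : False := by
  -- Chosen so that ∫ dx/(√C (x − z)) over (z + η, z + δ), which is log(δ/η)/√C, equals |τ| + 1/√C >
  -- τ.
  set η := δ * Real.exp (-(√C * |τ| + 1)) with hη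
  have hη0 : 0 < η := by positivity
  have hηδ : η < δ := by
    have : Real.exp (-(√C * |τ| + 1)) < 1 := by
      rw [Real.exp_lt_one_iff]; have : 0 ≤ √C * |τ| := by positivity
      linarith
    nlinarith
  obtain ⟨μ, c, d, hμ, hb, hsub, hle⟩ := h η ⟨hη0, hηδ⟩
  have hint := hb.integrableOn hS hF
  have h1 : ∫ x in Ioo (z + η) (z + δ), 1 / √(F x - μ) ≤ τ := by
    rw [← hb.setIntegral_eq hμ hT]
    exact setIntegral_mono_set hint (Eventually.of_forall fun x => by positivity)
      (Eventually.of_forall hsub)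
  have hcont : ContinuousOn (fun x : ℝ => (√C)⁻¹ * (x - z)⁻¹) (Icc (z + η) (z + δ)) := by
    refine continuousOn_const.mul (ContinuousOn.inv₀ (by fun_prop) fun x hx => ?_)
    have := hx.1
    exact ne_of_gt (by linarith)
  have h2 : ∫ x in Ioo (z + η) (z + δ), (√C)⁻¹ * (x - z)⁻¹ ≤
      ∫ x in Ioo (z + η) (z + δ), 1 / √(F x - μ) := by
    refine setIntegral_mono_on (hcont.integrableOn_Icc.mono_set Ioo_subset_Icc_self)
      (hint.mono_set hsub) measurableSet_Ioo fun x hx => ?_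
    have hxz : 0 < x - z := by linarith [hx.1]
    have h3 : 0 < F x - μ := by linarith [hb.above x (hsub hx)]
    rw [← mul_inv, one_div]
    refine inv_anti₀ (Real.sqrt_pos.2 h3) ?_
    calc √(F x - μ) ≤ √(C * (x - z) ^ 2) := Real.sqrt_le_sqrt (hle x hx)
      _ = √C * (x - z) := by rw [Real.sqrt_mul hC.le, Real.sqrt_sq hxz.le]
  have h4 : ∫ x in Ioo (z + η) (z + δ), (√C)⁻¹ * (x - z)⁻¹ = (√C)⁻¹ * (√C * |τ| + 1) := by
    rw [← integral_Ioc_eq_integral_Ioo, ← intervalIntegral.integral_of_le (by linarith),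
      intervalIntegral.integral_const_mul,
      intervalIntegral.integral_comp_sub_right (fun x => x⁻¹) z]
    simp only [add_sub_cancel_left]
    rw [integral_inv_of_pos hη0 hδ]
    congr 1
    have : δ / η = Real.exp (√C * |τ| + 1) := by
      rw [hη, Real.exp_neg]; field_simp
    rw [this, Real.log_exp]
  have hC' : 0 < √C := Real.sqrt_pos.2 hC
  have h5 : (√C)⁻¹ * (√C * |τ| + 1) = |τ| + (√C)⁻¹ := by field_simp
  have h6 : 0 < (√C)⁻¹ := by positivity
  linarith [le_abs_self τ]

/-- Differentiability of F' at its zero `z` gives F'(x) ≤ C(x − z) nearby; comparing derivatives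
yields the bound. -/
theorem exists_quadratic_bound {F : ℝ → ℝ} {S : Set ℝ} {z : ℝ} (hS : IsOpen S)
    (hF : ContDiffOn ℝ 2 F S) (hz : z ∈ S) (hz' : deriv F z = 0) :
    ∃ δ > 0, ∃ C > 0, ∀ x ∈ Icc z (z + δ), F x ≤ F z + C * (x - z) ^ 2 := by
  have h1 : ContDiffOn ℝ 1 (deriv F) S := hF.deriv_of_isOpen hS (by norm_num)
  have h2 : DifferentiableAt ℝ (deriv F) z :=
    (h1.differentiableOn (by norm_num)).differentiableAt (hS.mem_nhds hz)
  obtain ⟨C, hC, hb⟩ := h2.hasDerivAt.isBigO_sub.exists_pos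
  rw [Asymptotics.isBigOWith_iff] at hb
  have hb2 := hb.and (hS.mem_nhds hz)
  obtain ⟨ε, hε, hball⟩ := Metric.eventually_nhds_iff.1 hb2
  refine ⟨ε / 2, by positivity, C, hC, ?_⟩
  have hmem : ∀ x ∈ Icc z (z + ε / 2), dist x z < ε := fun x hx => by
    rw [Real.dist_eq, abs_of_nonneg (by linarith [hx.1])]; linarith [hx.2]
  refine image_le_of_deriv_right_le_deriv_boundary (f' := deriv F)
    (B' := fun x => C * (2 * (x - z))) ?_ ?_ ?_ ?_ ?_ ?_
  · exact fun x hx => (hF.differentiableAt_of_isOpen hS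
      (hball (hmem x hx)).2).continuousAt.continuousWithinAt
  · exact fun x hx => (hF.differentiableAt_of_isOpen hS
      (hball (hmem x ⟨hx.1, hx.2.le⟩)).2).hasDerivAt.hasDerivWithinAt
  · simp
  · fun_prop
  · intro x _
    have h := (((hasDerivAt_id x).sub_const z).pow 2).const_mul C |>.const_add (F z)
    simpa using h.hasDerivWithinAt
  · intro x hx
    have h3 := (hball (hmem x ⟨hx.1, hx.2.le⟩)).1
    have hxz : 0 ≤ x - z := by linarith [hx.1]
    rw [hz', sub_zero, Real.norm_eq_abs, Real.norm_eq_abs, abs_of_nonneg hxz] at h3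
    have := le_abs_self (deriv F x)
    nlinarith [mul_nonneg hC.le hxz]

theorem IsBump.of_regular {F : ℝ → ℝ} {S : Set ℝ} {a b c d μ : ℝ} (hsub : Icc a b ⊆ S)
    (hac : a ≤ c) (hcd : c < d) (hdb : d ≤ b) (hc : F c = μ) (hd : F d = μ)
    (habove : ∀ x ∈ Ioo c d, μ < F x) (hreg : ∀ x ∈ S, F x = μ → deriv F x ≠ 0) :
    IsBump F S μ c d where
  lt := hcd
  subset := (Icc_subset_Icc hac hdb).trans hsub
  left := hc
  right := hd
  above := habove
  deriv_left := hreg c (hsub ⟨hac, hcd.le.trans hdb⟩) hc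
  deriv_right := hreg d (hsub ⟨hac.trans hcd.le, hdb⟩) hd

/-- A critical point from which `F` does not descend to one side cannot lie above the end points
of an interval. -/
theorem HasConstantPeriod.not_critical_inside {F : ℝ → ℝ} {S : Set ℝ} {τ a b z q : ℝ}
    (hT : HasConstantPeriod F S τ) (hS : IsOpen S) (hF : ContDiffOn ℝ 2 F S)
    (hsub : Icc a b ⊆ S) (haz : a ≤ z) (hzq : z < q) (hqb : q ≤ b) (ha : F a < F z)
    (hb : F b < F z) (h0 : 0 < F z) (hge : ∀ x ∈ Icc z q, F z ≤ F x) : deriv F z ≠ 0 := by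
  intro hz'
  have hzS : z ∈ S := hsub ⟨haz, hzq.le.trans hqb⟩
  obtain ⟨δ, hδ, C, hC, hquad⟩ := exists_quadratic_bound hS hF hzS hz'
  set δ' := min δ (q - z)
  have hδ' : 0 < δ' := lt_min hδ (by linarith)
  refine false_of_quadratic_contact (z := z) (δ := δ') (C := 2 * C) hS hF hT hδ' (by positivity)
    fun η hη => ?_
  -- A level within Cη² of F(z) adds at most C(x − z)² to the height once x − z ≥ η; hence the
  -- constant 2C.
  have hlt : max (max (F a) (F b)) (max 0 (F z - C * η ^ 2)) < F z :=
    max_lt (max_lt ha hb) (max_lt h0 (by have := hη.1; have : 0 < C * η ^ 2 := by positivity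
                                         linarith))
  obtain ⟨μ, hμ, hreg⟩ := exists_mem_Ioo_of_ae
    (ae_regular_value fun x hx => hF.differentiableAt_of_isOpen hS hx) hlt
  have hμ1 := hμ.1
  simp only [max_lt_iff] at hμ1
  obtain ⟨⟨h1, h2⟩, h3, h4⟩ := hμ1
  obtain ⟨c, d, hac, hcz, hqd, hdb, hFc, hFd, habove⟩ := exists_component haz hzq.le hqb
    (hF.continuousOn.mono hsub) h1.le h2.le (fun x hx => hμ.2.trans_le (hge x hx))
  refine ⟨μ, c, d, h3.le, IsBump.of_regular hsub hac (by linarith) hdb hFc hFd habove hreg,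
    fun x hx => ⟨by linarith [hx.1, hη.1], ?_⟩, fun x hx => ?_⟩
  · have := min_le_right δ (q - z)
    linarith [hx.2]
  · have h5 := hquad x ⟨by linarith [hx.1, hη.1], by linarith [hx.2, min_le_left δ (q - z)]⟩
    have h6 : η ^ 2 ≤ (x - z) ^ 2 := pow_le_pow_left₀ hη.1.le (by linarith [hx.1]) 2
    nlinarith

/-- If the left end were critical, bumps over regular levels slightly above `n` would approach `a`
and their periods would diverge logarithmically. -/
theorem HasConstantPeriod.not_critical_left {F : ℝ → ℝ} {S : Set ℝ} {τ a b n : ℝ}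
    (hT : HasConstantPeriod F S τ) (hS : IsOpen S) (hF : ContDiffOn ℝ 2 F S)
    (hsub : Icc a b ⊆ S) (hab : a < b) (ha : F a = n) (hb : F b = n) (h0 : 0 ≤ n)
    (hgt : ∀ x ∈ Ioo a b, n < F x) : deriv F a ≠ 0 := by
  intro hz'
  obtain ⟨δ, hδ, C, hC, hquad⟩ :=
    exists_quadratic_bound hS hF (hsub (left_mem_Icc.2 hab.le)) hz'
  set δ' := min δ ((b - a) / 2)
  have hδ' : 0 < δ' := lt_min hδ (by linarith)
  have hδb : a + δ' < b := by linarith [min_le_right δ ((b - a) / 2)]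
  refine false_of_quadratic_contact (z := a) (δ := δ') (C := C) hS hF hT hδ' hC
    fun η hη => ?_
  have hKsub : Icc (a + η) (a + δ') ⊆ Ioo a b := fun x hx =>
    ⟨by linarith [hx.1, hη.1], by linarith [hx.2]⟩
  have hcont := hF.continuousOn.mono hsub
  obtain ⟨m, hm, hmin⟩ := isCompact_Icc.exists_isMinOn
    (nonempty_Icc.2 (by linarith [hη.2] : a + η ≤ a + δ'))
    (hcont.mono (hKsub.trans Ioo_subset_Icc_self))
  obtain ⟨μ, hμ, hreg⟩ := exists_mem_Ioo_of_ae
    (ae_regular_value fun x hx => hF.differentiableAt_of_isOpen hS hx) (hgt m (hKsub hm))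
  obtain ⟨c, d, hac, hcz, hqd, hdb, hFc, hFd, habove⟩ := exists_component
    (a := a) (b := b) (z := a + η) (q := a + δ') (by linarith [hη.1]) (by linarith [hη.2]) hδb.le
    hcont (by linarith [hμ.1]) (by linarith [hμ.1]) (fun x hx => hμ.2.trans_le (hmin hx))
  refine ⟨μ, c, d, by linarith [hμ.1],
    IsBump.of_regular hsub hac (by linarith [hη.2]) hdb hFc hFd habove hreg,
    fun x hx => ⟨by linarith [hx.1], by linarith [hx.2]⟩, fun x hx => ?_⟩
  have h5 := hquad x ⟨by linarith [hx.1, hη.1],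
    by linarith [hx.2, min_le_left δ ((b - a) / 2)]⟩
  rw [ha] at h5
  linarith [hμ.1]

theorem HasConstantPeriod.not_critical_right {F : ℝ → ℝ} {S : Set ℝ} {τ a b n : ℝ}
    (hT : HasConstantPeriod F S τ) (hS : IsOpen S) (hF : ContDiffOn ℝ 2 F S)
    (hsub : Icc a b ⊆ S) (hab : a < b) (ha : F a = n) (hb : F b = n) (h0 : 0 ≤ n)
    (hgt : ∀ x ∈ Ioo a b, n < F x) : deriv F b ≠ 0 := by
  have h := hT.reflect.not_critical_left (a := -b) (b := -a) (n := n) hS.reflect hF.reflect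
    (fun x hx => hsub ⟨by linarith [hx.2], by linarith [hx.1]⟩) (by linarith) (by simpa)
    (by simpa) h0 (fun x hx => hgt _ ⟨by linarith [hx.2], by linarith [hx.1]⟩)
  simpa [deriv_comp_neg_at] using h

end Bumps

/-! ### Unimodality of bumps and the area law by Abel inversion. -/

section Area

open MeasureTheory Filter Topology

/-- Inside a bump `F` has no valley. -/
theorem IsBump.not_valley {F : ℝ → ℝ} {S : Set ℝ} {τ ℓ a b x c q : ℝ} (h : IsBump F S ℓ a b)
    (hℓ : 0 ≤ ℓ) (hT : HasConstantPeriod F S τ) (hS : IsOpen S) (hF : ContDiffOn ℝ 2 F S)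
    (hax : a ≤ x) (hxc : x < c) (hcq : c < q) (hqb : q ≤ b) (h1 : F c < F x) (h2 : F c < F q) :
    False := by
  have hcont : ContinuousOn F (Icc x q) := hF.continuousOn.mono
    ((Icc_subset_Icc hax hqb).trans h.subset)
  obtain ⟨z, hz, hmin⟩ := isCompact_Icc.exists_isMinOn
    (nonempty_Icc.2 (hxc.trans hcq).le) hcont
  have hzc : F z ≤ F c := hmin ⟨hxc.le, hcq.le⟩
  have hxz : x < z := lt_of_le_of_ne hz.1 (by rintro rfl; linarith)
  have hzq : z < q := lt_of_le_of_ne hz.2 (by rintro rfl; linarith)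
  have hzℓ : ℓ < F z := h.above z ⟨hax.trans_lt hxz, hzq.trans_le hqb⟩
  -- The minimizer over [x, q] is an interior critical point, above the level of the bump's ends,
  -- with no smaller value to its right up to `q`.
  refine hT.not_critical_inside hS hF h.subset (hax.trans hxz.le) hzq hqb (by rwa [h.left])
    (by rwa [h.right]) (hℓ.trans_lt hzℓ) (fun y hy => hmin ⟨hxz.le.trans hy.1, hy.2⟩) ?_
  exact (hmin.isLocalMin (Icc_mem_nhds hxz hzq)).deriv_eq_zero

/-- Superlevel sets of regular levels are intervals. -/
theorem IsBump.exists_superlevel {F : ℝ → ℝ} {S : Set ℝ} {τ ℓ a b q μ : ℝ} (h : IsBump F S ℓ a b)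
    (hℓ : 0 ≤ ℓ) (hT : HasConstantPeriod F S τ) (hS : IsOpen S) (hF : ContDiffOn ℝ 2 F S)
    (hq : q ∈ Icc a b) (hμ : ℓ < μ) (hμq : μ < F q)
    (hreg : ∀ x ∈ S, F x = μ → deriv F x ≠ 0) :
    ∃ c d, IsBump F S μ c d ∧ a < c ∧ c < q ∧ q < d ∧ d < b ∧
      ∀ x ∈ Icc a b, μ < F x → x ∈ Ioo c d := by
  obtain ⟨c, d, hac, hcz, hqd, hdb, hFc, hFd, habove⟩ := exists_component (z := q) (q := q)
    (μ := μ)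
    hq.1 le_rfl hq.2 (hF.continuousOn.mono h.subset) (by rw [h.left]; exact hμ.le)
    (by rw [h.right]; exact hμ.le)
    (fun x hx => by rwa [le_antisymm hx.2 hx.1])
  refine ⟨c, d, IsBump.of_regular h.subset hac (hcz.trans hqd) hdb hFc hFd habove hreg,
    lt_of_le_of_ne hac ?_, hcz, hqd, lt_of_le_of_ne hdb ?_, fun x hx hxμ => ⟨?_, ?_⟩⟩
  · rintro rfl; linarith [h.left]
  · rintro rfl; linarith [h.right]
  · by_contra hcon
    have hxc : x < c := lt_of_le_of_ne (not_lt.1 hcon) (by rintro rfl; linarith)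
    exact h.not_valley hℓ hT hS hF hx.1 hxc hcz hq.2 (by linarith) (by linarith)
  · by_contra hcon
    have hxc : d < x := lt_of_le_of_ne (not_lt.1 hcon) (by rintro rfl; linarith)
    exact h.not_valley hℓ hT hS hF hq.1 hqd hxc hx.2 (by linarith) (by linarith)

/-- The constant `∫₀¹ √t / √(1 - t) dt`. -/
noncomputable def abelConst : ℝ := ∫ t in (0 : ℝ)..1, √t / √(1 - t)

theorem intervalIntegrable_abel :
    IntervalIntegrable (fun t : ℝ => √t / √(1 - t)) volume 0 1 := by
  have h3 : IntervalIntegrable (fun x : ℝ => (1 - x) ^ (-(1/2) : ℝ)) volume 0 1 := by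
    have := (intervalIntegral.intervalIntegrable_rpow' (a := 1 - 0) (b := 1 - 1)
        (r := (-(1/2) : ℝ)) (by norm_num)).comp_sub_left 1
    simpa using this
  refine h3.mono_fun (Measurable.div (by fun_prop) (by fun_prop)).aestronglyMeasurable ?_
  rw [uIoc_of_le zero_le_one]
  refine (ae_restrict_iff' measurableSet_Ioc).2 (Eventually.of_forall fun t ht => ?_)
  have h1 : 0 ≤ 1 - t := by linarith [ht.2]
  beta_reduce
  rw [Real.rpow_neg h1, ← Real.sqrt_eq_rpow, Real.norm_of_nonneg (by positivity),
    Real.norm_of_nonneg (by positivity), ← one_div]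
  gcongr
  exact Real.sqrt_le_one.2 ht.2

theorem abelConst_pos : 0 < abelConst := by
  refine intervalIntegral.intervalIntegral_pos_of_pos_on intervalIntegrable_abel (fun t ht => ?_)
    zero_lt_one
  have h1 := Real.sqrt_pos.2 ht.1
  have h2 := Real.sqrt_pos.2 (sub_pos.2 ht.2)
  positivity

/-- Rescaling (s, e) to (0, 1) gives the constant. The integral may run over all levels, because `√`
vanishes on negative reals and division by zero gives zero. -/
theorem lintegral_abel (s e : ℝ) :
    ∫⁻ μ : ℝ, ENNReal.ofReal (√(μ - s) / √(e - μ)) = ENNReal.ofReal (abelConst * (e - s)) := by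
  rcases le_or_gt e s with hes | hse
  · rw [ENNReal.ofReal_of_nonpos (mul_nonpos_of_nonneg_of_nonpos abelConst_pos.le (by linarith))]
    refine (lintegral_congr fun μ => ?_).trans lintegral_zero
    rcases le_or_gt μ s with h | h
    · rw [Real.sqrt_eq_zero_of_nonpos (by linarith : μ - s ≤ 0)]; simp
    · rw [Real.sqrt_eq_zero_of_nonpos (by linarith : e - μ ≤ 0)]; simp
  · have hpos : 0 < e - s := by linarith
    have hscale : ∀ t : ℝ, √((e - s) * t + s - s) / √(e - ((e - s) * t + s)) =
        √t / √(1 - t) := fun t => by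
      have h1 : (e - s) * t + s - s = (e - s) * t := by ring
      have h2 : e - ((e - s) * t + s) = (e - s) * (1 - t) := by ring
      rw [h1, h2, Real.sqrt_mul hpos.le, Real.sqrt_mul hpos.le,
        mul_div_mul_left _ _ (Real.sqrt_pos.2 hpos).ne']
    have hval : ∫ μ in s..e, √(μ - s) / √(e - μ) = abelConst * (e - s) := by
      have h1 := intervalIntegral.integral_comp_mul_add (a := 0) (b := 1)
        (fun μ : ℝ => √(μ - s) / √(e - μ)) hpos.ne' s
      simp only [hscale] at h1
      rw [show (e - s) * 0 + s = s by ring, show (e - s) * 1 + s = e by ring] at h1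
      rw [abelConst, h1, smul_eq_mul]
      field_simp
    have hint : IntervalIntegrable (fun μ : ℝ => √(μ - s) / √(e - μ)) volume s e := by
      have h1 := (intervalIntegrable_abel.comp_mul_left (c := (e - s)⁻¹)).comp_sub_right s
      rw [zero_div, one_div, inv_inv, zero_add, sub_add_cancel] at h1
      refine h1.congr (fun μ _ => ?_)
      have := hscale ((e - s)⁻¹ * (μ - s))
      rw [mul_inv_cancel_left₀ hpos.ne', sub_add_cancel] at this
      exact this.symm
    rw [← hval, intervalIntegral.integral_of_le hse.le, ofReal_integral_eq_lintegral_ofReal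
      ((intervalIntegrable_iff_integrableOn_Ioc_of_le hse.le).1 hint)
      (Eventually.of_forall fun μ => by positivity)]
    refine (setLIntegral_eq_of_support_subset ?_).symm
    intro μ hμ
    rw [Function.mem_support] at hμ
    constructor
    · by_contra h
      exact hμ (by rw [Real.sqrt_eq_zero_of_nonpos (by linarith : μ - s ≤ 0)]; simp)
    · by_contra h
      exact hμ (by rw [Real.sqrt_eq_zero_of_nonpos (by linarith : e - μ ≤ 0)]; simp)

theorem lintegral_sqrt_sub {s e : ℝ} (hse : s ≤ e) :
    ∫⁻ μ in Ioo s e, ENNReal.ofReal √(μ - s) = ENNReal.ofReal (2 / 3 * √(e - s) ^ 3) := by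
  have hval : ∫ μ in s..e, √(μ - s) = 2 / 3 * √(e - s) ^ 3 := by
    rw [intervalIntegral.integral_comp_sub_right (fun x => √x) s]
    simp only [sub_self, Real.sqrt_eq_rpow]
    rw [integral_rpow (Or.inl (by norm_num)), ← Real.rpow_natCast, ← Real.rpow_mul (by linarith)]
    norm_num
    ring
  rw [← hval, intervalIntegral.integral_of_le hse, integral_Ioc_eq_integral_Ioo,
    ofReal_integral_eq_lintegral_ofReal _ (Eventually.of_forall fun μ => by positivity)]
  exact (Continuous.integrableOn_Icc (by fun_prop)).mono_set Ioo_subset_Icc_self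

/-- The area of a bump above the level `μ` is proportional to the power `3/2` of the height. -/
theorem IsBump.area {F : ℝ → ℝ} {S : Set ℝ} {τ ℓ a b q μ : ℝ} (h : IsBump F S ℓ a b)
    (hℓ : 0 ≤ ℓ) (hT : HasConstantPeriod F S τ) (hS : IsOpen S) (hF : ContDiffOn ℝ 2 F S)
    (hq : q ∈ Icc a b) (hmax : ∀ x ∈ Icc a b, F x ≤ F q) (hμ : ℓ ≤ μ) (hμq : μ ≤ F q)
    (hτ : 0 ≤ τ) :
    abelConst * ∫ x in a..b, max (F x - μ) 0 = τ * (2 / 3 * √(F q - μ) ^ 3) := by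
  have hcont := hF.continuousOn.mono h.subset
  have hmeas : AEMeasurable F (volume.restrict (Ioo a b)) :=
    (hcont.mono Ioo_subset_Icc_self).aemeasurable measurableSet_Ioo
  have hlhs : ENNReal.ofReal (abelConst * ∫ x in a..b, max (F x - μ) 0) =
      ∫⁻ x in Ioo a b, ENNReal.ofReal (abelConst * (F x - μ)) := by
    rw [intervalIntegral.integral_of_le h.lt.le, integral_Ioc_eq_integral_Ioo,
      ← integral_const_mul, ofReal_integral_eq_lintegral_ofReal]
    · refine lintegral_congr fun x => ?_
      rcases le_total (F x - μ) 0 with h1 | h1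
      · rw [max_eq_right h1, mul_zero, ENNReal.ofReal_zero, ENNReal.ofReal_of_nonpos]
        exact mul_nonpos_of_nonneg_of_nonpos abelConst_pos.le h1
      · rw [max_eq_left h1]
    · refine Integrable.const_mul ?_ _
      exact (ContinuousOn.integrableOn_Icc ((hcont.sub continuousOn_const).sup
        continuousOn_const)).mono_set Ioo_subset_Icc_self
    · exact Eventually.of_forall fun x => mul_nonneg abelConst_pos.le (le_max_right _ _)
  -- Abel's trick: write the height F(x) − μ as an integral over levels ν and apply Tonelli.
  have hswap : ∫⁻ x in Ioo a b, ENNReal.ofReal (abelConst * (F x - μ)) =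
      ∫⁻ ν : ℝ, ∫⁻ x in Ioo a b, ENNReal.ofReal (√(ν - μ) / √(F x - ν)) := by
    rw [← lintegral_lintegral_swap]
    · exact lintegral_congr fun x => (lintegral_abel μ (F x)).symm
    · have h1 : AEMeasurable (fun p : ℝ × ℝ => F p.1) ((volume.restrict (Ioo a b)).prod volume) :=
        hmeas.comp_fst
      exact (((measurable_snd.aemeasurable.sub_const μ).sqrt).div
        ((h1.sub measurable_snd.aemeasurable).sqrt)).ennreal_ofReal
  -- For regular ν strictly between μ and the maximum, {F > ν} is one bump, whose period is τ.
  have hinner : ∀ᵐ ν : ℝ, ∫⁻ x in Ioo a b, ENNReal.ofReal (√(ν - μ) / √(F x - ν)) =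
      (Ioo μ (F q)).indicator (fun ν => ENNReal.ofReal √(ν - μ) * ENNReal.ofReal τ) ν := by
    filter_upwards [ae_regular_value fun x hx => hF.differentiableAt_of_isOpen hS hx] with ν hreg
    by_cases hν : ν ∈ Ioo μ (F q)
    · rw [indicator_of_mem hν]
      obtain ⟨c, d, hb, hac, hcq, hqd, hdb, hsup⟩ :=
        h.exists_superlevel hℓ hT hS hF hq (hμ.trans_lt hν.1) hν.2 hreg
      rw [← hb.lintegral_eq (hℓ.trans (hμ.trans hν.1.le)) hT hS hF,
        ← lintegral_const_mul' _ _ ENNReal.ofReal_ne_top]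
      have h1 : ∀ x, ENNReal.ofReal (√(ν - μ) / √(F x - ν)) =
          ENNReal.ofReal √(ν - μ) * ENNReal.ofReal (1 / √(F x - ν)) := fun x => by
        rw [← ENNReal.ofReal_mul (Real.sqrt_nonneg _), mul_one_div]
      simp only [h1]
      rw [← lintegral_indicator measurableSet_Ioo, ← lintegral_indicator measurableSet_Ioo]
      refine lintegral_congr fun x => ?_
      by_cases hx : x ∈ Ioo c d
      · rw [indicator_of_mem hx,
          indicator_of_mem (show x ∈ Ioo a b from ⟨hac.trans hx.1, hx.2.trans hdb⟩)]
      · rw [indicator_of_notMem hx]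
        by_cases hx' : x ∈ Ioo a b
        · rw [indicator_of_mem hx']
          have : F x - ν ≤ 0 := by
            by_contra hcon
            exact hx (hsup x (Ioo_subset_Icc_self hx') (by linarith))
          rw [Real.sqrt_eq_zero_of_nonpos this]; simp
        · rw [indicator_of_notMem hx']
    · rw [indicator_of_notMem hν]
      refine (setLIntegral_congr_fun measurableSet_Ioo fun x hx => ?_).trans lintegral_zero
      rcases le_or_gt ν μ with h1 | h1
      · rw [Real.sqrt_eq_zero_of_nonpos (by linarith : ν - μ ≤ 0)]; simp
      · have h2 : F q ≤ ν := by
          by_contra hcon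
          exact hν ⟨h1, not_le.1 hcon⟩
        rw [Real.sqrt_eq_zero_of_nonpos
          (by linarith [hmax x (Ioo_subset_Icc_self hx)] : F x - ν ≤ 0)]; simp
  have hfin : ENNReal.ofReal (abelConst * ∫ x in a..b, max (F x - μ) 0) =
      ENNReal.ofReal (τ * (2 / 3 * √(F q - μ) ^ 3)) := by
    rw [hlhs, hswap, lintegral_congr_ae hinner, lintegral_indicator measurableSet_Ioo,
      lintegral_mul_const' _ _ ENNReal.ofReal_ne_top, lintegral_sqrt_sub hμq,
      ← ENNReal.ofReal_mul (by positivity), mul_comm τ]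
  have h0 : 0 ≤ ∫ x in a..b, max (F x - μ) 0 :=
    intervalIntegral.integral_nonneg h.lt.le fun x _ => le_max_right _ _
  exact (ENNReal.ofReal_eq_ofReal_iff (mul_nonneg abelConst_pos.le h0) (by positivity)).1 hfin

theorem IsBump.period_nonneg {F : ℝ → ℝ} {S : Set ℝ} {τ ℓ a b : ℝ} (h : IsBump F S ℓ a b)
    (hℓ : 0 ≤ ℓ) (hT : HasConstantPeriod F S τ) : 0 ≤ τ := by
  rw [← hT ℓ a b hℓ h]
  exact intervalIntegral.integral_nonneg h.lt.le fun x _ => by positivity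

end Area

/-! ### The gap above the curve and the dependence of its area on slope and level. -/

section Arcs

open MeasureTheory Filter Topology

/-- The height `ξ x - Y x` of the line of slope `ξ` through the origin over the curve `Y`. -/
def lineGap (Y : ℝ → ℝ) (ξ x : ℝ) : ℝ := ξ * x - Y x

theorem ContDiffOn.lineGap {Y : ℝ → ℝ} {J : Set ℝ} (hY : ContDiffOn ℝ 2 Y J) (ξ : ℝ) :
    ContDiffOn ℝ 2 (lineGap Y ξ) J :=
  (contDiff_const.mul contDiff_id).contDiffOn.sub hY

theorem IsBump.period_pos {F : ℝ → ℝ} {S : Set ℝ} {τ ℓ a b : ℝ} (h : IsBump F S ℓ a b)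
    (hℓ : 0 ≤ ℓ) (hT : HasConstantPeriod F S τ) (hS : IsOpen S) (hF : ContDiffOn ℝ 2 F S) :
    0 < τ := by
  rw [← hT ℓ a b hℓ h]
  refine intervalIntegral.intervalIntegral_pos_of_pos_on
    ((intervalIntegrable_iff_integrableOn_Ioo_of_le h.lt.le).2 (h.integrableOn hS hF))
    (fun x hx => ?_) h.lt
  exact one_div_pos.2 (Real.sqrt_pos.2 (sub_pos.2 (h.above x hx)))

/-- The area formula for nearby slopes, over a fixed interval. -/
theorem IsBump.eventually_area {Y τ : ℝ → ℝ} {J : Set ℝ} {ξ₀ ℓ a b μ : ℝ} (hJ : IsOpen J)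
    (hY : ContDiffOn ℝ 2 Y J) (hT : ∀ ξ, HasConstantPeriod (lineGap Y ξ) J (τ ξ))
    (h : IsBump (lineGap Y ξ₀) J ℓ a b) (hℓ : 0 ≤ ℓ) (hμ : ℓ < μ)
    (hμM : μ < sSup (lineGap Y ξ₀ '' Icc a b)) :
    ∀ᶠ ξ in 𝓝 ξ₀, 0 ≤ τ ξ ∧ μ ≤ sSup (lineGap Y ξ '' Icc a b) ∧
      abelConst * ∫ x in a..b, max (lineGap Y ξ x - μ) 0 =
        τ ξ * (2 / 3 * √(sSup (lineGap Y ξ '' Icc a b) - μ) ^ 3) := by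
  have hc : ∀ ξ, ContinuousOn (lineGap Y ξ) (Icc a b) := fun ξ =>
    (hY.lineGap ξ).continuousOn.mono h.subset
  have hne : (Icc a b).Nonempty := nonempty_Icc.2 h.lt.le
  obtain ⟨q₀, hq₀, hq₀M⟩ := isCompact_Icc.exists_sSup_image_eq hne (hc ξ₀)
  rw [hq₀M] at hμM
  obtain ⟨μ₂, hμ₂, hreg⟩ := exists_mem_Ioo_of_ae
    (ae_regular_value fun x hx => (hY.lineGap ξ₀).differentiableAt_of_isOpen hJ hx) hμ
  obtain ⟨c₂, d₂, hb₂, hac₂, hcq₂, hqd₂, hdb₂, hsup₂⟩ :=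
    h.exists_superlevel hℓ (hT ξ₀) hJ (hY.lineGap ξ₀) hq₀ hμ₂.1 (hμ₂.2.trans hμM) hreg
  -- The three bounds serve in turn to leave room for a level ν in (ℓ + ε, μ₂ − ε), to keep the
  -- perturbed gap below μ where the original is at most μ₂, and to keep its maximum above μ.
  obtain ⟨ε, hε, hε'⟩ := exists_between (a₁ := 0)
    (a₂ := min (min ((μ₂ - ℓ) / 2) (μ - μ₂)) (lineGap Y ξ₀ q₀ - μ))
    (lt_min (lt_min (by linarith [hμ₂.1]) (by linarith [hμ₂.2])) (by linarith))
  simp only [lt_min_iff] at hε'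
  obtain ⟨⟨hε1, hε2⟩, hε3⟩ := hε'
  set R := |a| + |b| + 1
  have hR : 0 < R := by positivity
  filter_upwards [Metric.ball_mem_nhds ξ₀ (div_pos hε hR)] with ξ hξ
  have hclose : ∀ x ∈ Icc a b, |lineGap Y ξ x - lineGap Y ξ₀ x| < ε := fun x hx => by
    have h1 : lineGap Y ξ x - lineGap Y ξ₀ x = (ξ - ξ₀) * x := by simp only [lineGap]; ring
    rw [Metric.mem_ball, Real.dist_eq, lt_div_iff₀ hR] at hξ
    have h2 : |x| ≤ R := by
      rw [abs_le]
      constructor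
      · linarith [neg_abs_le a, abs_nonneg b, hx.1]
      · linarith [le_abs_self b, abs_nonneg a, hx.2]
    rw [h1, abs_mul]
    exact (mul_le_mul_of_nonneg_left h2 (abs_nonneg _)).trans_lt hξ
  obtain ⟨ν, hν, hregν⟩ := exists_mem_Ioo_of_ae
    (ae_regular_value fun x hx => (hY.lineGap ξ).differentiableAt_of_isOpen hJ hx)
    (by linarith : ℓ + ε < μ₂ - ε)
  have hca := abs_lt.1 (hclose a (left_mem_Icc.2 h.lt.le))
  have hcb := abs_lt.1 (hclose b (right_mem_Icc.2 h.lt.le))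
  have hlarge : ∀ x ∈ Icc c₂ d₂, ν < lineGap Y ξ x := fun x hx => by
    have h1 := abs_lt.1 (hclose x ⟨hac₂.le.trans hx.1, hx.2.trans hdb₂.le⟩)
    have h2 : μ₂ ≤ lineGap Y ξ₀ x := by
      rcases hx.1.eq_or_lt with h3 | h3
      · rw [← h3, hb₂.left]
      · rcases hx.2.eq_or_lt with h4 | h4
        · rw [h4, hb₂.right]
        · exact (hb₂.above x ⟨h3, h4⟩).le
    linarith [hν.2]
  -- The perturbed gap is below ν at `a` and `b` and above ν on [c₂, d₂], so a bump of the new slope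
  -- survives inside [a, b] and carries all of the area above μ.
  obtain ⟨c, d, hac, hcc₂, hdd₂, hdb, hFc, hFd, habove⟩ := exists_component hac₂.le hb₂.lt.le
    hdb₂.le (hc ξ) (by linarith [h.left, hν.1]) (by linarith [h.right, hν.1]) hlarge
  have hb : IsBump (lineGap Y ξ) J ν c d := IsBump.of_regular h.subset hac
    (hcc₂.trans (hb₂.lt.trans hdd₂)) hdb hFc hFd habove hregν
  have hsmall : ∀ x ∈ Icc a b, x ∉ Ioo c d → lineGap Y ξ x < μ := fun x hx hx' => by
    have h1 := abs_lt.1 (hclose x hx)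
    have h2 : lineGap Y ξ₀ x ≤ μ₂ := by
      by_contra hcon
      have := hsup₂ x hx (not_le.1 hcon)
      exact hx' ⟨hcc₂.trans this.1, this.2.trans hdd₂⟩
    linarith
  obtain ⟨q, hq, hqM, hqmax⟩ := isCompact_Icc.exists_sSup_image_eq_and_ge hne (hc ξ)
  have hμq : μ < lineGap Y ξ q := by
    have h1 := abs_lt.1 (hclose q₀ hq₀)
    linarith [hqmax q₀ hq₀]
  have hqcd : q ∈ Ioo c d := by
    by_contra hcon
    exact absurd (hsmall q hq hcon) (not_lt.2 hμq.le)
  have hν0 : 0 ≤ ν := by linarith [hν.1]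
  rw [hqM]
  have hτ := hb.period_nonneg hν0 (hT ξ)
  refine ⟨hτ, hμq.le, ?_⟩
  rw [← hb.area hν0 (hT ξ) hJ (hY.lineGap ξ) (Ioo_subset_Icc_self hqcd)
    (fun x hx => hqmax x ⟨hac.trans hx.1, hx.2.trans hdb⟩) (by linarith [hν.2]) hμq.le hτ]
  congr 1
  rw [intervalIntegral.integral_of_le h.lt.le, intervalIntegral.integral_of_le hb.lt.le]
  refine setIntegral_eq_of_subset_of_forall_sdiff_eq_zero measurableSet_Ioc
    (Ioc_subset_Ioc hac hdb) fun x hx => ?_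
  have := hsmall x (Ioc_subset_Icc_self hx.1) (fun h' => hx.2 (Ioo_subset_Ioc_self h'))
  exact max_eq_right (by linarith)

/-- The positive part is Lipschitz in the parameter and differentiable wherever f ≠ 0, so dominated
differentiation applies. Motion of the ends contributes nothing. -/
theorem hasDerivAt_integral_posPart {f φ : ℝ → ℝ} {a b c d s₀ : ℝ} (hac : a ≤ c) (hcd : c ≤ d)
    (hdb : d ≤ b) (hf : ContinuousOn f (Icc a b)) (hφ : Continuous φ)
    (hpos : ∀ x ∈ Icc a b, 0 < f x ↔ x ∈ Ioo c d) (hnull : ∀ᵐ x : ℝ, x ∈ Icc a b → f x ≠ 0) :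
    HasDerivAt (fun s => ∫ x in a..b, max (f x + (s - s₀) * φ x) 0) (∫ x in c..d, φ x) s₀ := by
  have hab : a ≤ b := hac.trans (hcd.trans hdb)
  have hIoc : uIoc a b = Ioc a b := uIoc_of_le hab
  have hcont : ∀ s, ContinuousOn (fun x => max (f x + (s - s₀) * φ x) 0) (Icc a b) := fun s =>
    (hf.add (continuous_const.mul hφ).continuousOn).sup continuousOn_const
  have key := intervalIntegral.hasDerivAt_integral_of_dominated_loc_of_lip (μ := volume)
    (F := fun s x => max (f x + (s - s₀) * φ x) 0) (F' := (Ioo c d).indicator φ)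
    (bound := fun x => |φ x|) (a := a) (b := b) (x₀ := s₀) (s := univ) univ_mem ?_ ?_ ?_ ?_ ?_ ?_
  · have h1 := key.2
    rw [intervalIntegral.integral_of_le hab, setIntegral_indicator measurableSet_Ioo,
      inter_eq_self_of_subset_right
        (show Ioo c d ⊆ Ioc a b from fun x hx => ⟨hac.trans_lt hx.1, (hx.2.trans_le hdb).le⟩),
      ← integral_Ioc_eq_integral_Ioo, ← intervalIntegral.integral_of_le hcd] at h1
    exact h1
  · refine Eventually.of_forall fun s => ?_
    rw [hIoc]
    exact ((hcont s).mono Ioc_subset_Icc_self).aestronglyMeasurable measurableSet_Ioc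
  · exact ContinuousOn.intervalIntegrable_of_Icc hab (hcont s₀)
  · exact hφ.aestronglyMeasurable.indicator measurableSet_Ioo
  · refine Eventually.of_forall fun x _ => LipschitzOnWith.of_dist_le_mul fun s _ t _ => ?_
    rw [Real.dist_eq, Real.dist_eq, Real.coe_nnabs, abs_abs]
    refine (abs_max_sub_max_le_abs _ _ _).trans (le_of_eq ?_)
    rw [← abs_mul]
    congr 1
    ring
  · exact hφ.abs.intervalIntegrable _ _
  · filter_upwards [hnull] with x hx hxI
    rw [hIoc] at hxI
    have hxab := Ioc_subset_Icc_self hxI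
    have hlin : HasDerivAt (fun s => f x + (s - s₀) * φ x) (φ x) s₀ := by
      simpa using (((hasDerivAt_id s₀).sub_const s₀).mul_const (φ x)).const_add (f x)
    have hval : (fun s => f x + (s - s₀) * φ x) s₀ = f x := by simp
    rcases lt_or_gt_of_ne (hx hxab) with h | h
    · have hnot : x ∉ Ioo c d := fun h' => absurd ((hpos x hxab).2 h') (not_lt.2 h.le)
      rw [indicator_of_notMem hnot]
      refine (hasDerivAt_const s₀ (0 : ℝ)).congr_of_eventuallyEq ?_
      have := hlin.continuousAt.eventually (gt_mem_nhds (by rw [hval]; exact h : _ < (0 : ℝ)))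
      filter_upwards [this] with s hs
      exact max_eq_right hs.le
    · rw [indicator_of_mem ((hpos x hxab).1 h)]
      refine hlin.congr_of_eventuallyEq ?_
      have := hlin.continuousAt.eventually (lt_mem_nhds (by rw [hval]; exact h : (0 : ℝ) < _))
      filter_upwards [this] with s hs
      exact max_eq_left hs.le

/-- Disjoint level sets can have positive measure for only countably many levels. -/
theorem ae_level_null {f : ℝ → ℝ} {a b : ℝ} (hf : ContinuousOn f (Icc a b)) :
    ∀ᵐ μ : ℝ, ∀ᵐ x : ℝ, x ∈ Icc a b → f x ≠ μ := by
  have h1 : NullMeasurable f (volume.restrict (Icc a b)) :=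
    (hf.aemeasurable measurableSet_Icc).nullMeasurable
  have h2 := (Measure.countable_meas_level_set_pos₀ h1).ae_notMem volume
  filter_upwards [h2] with μ hμ
  have h3 : volume.restrict (Icc a b) {x | f x = μ} = 0 := by
    simpa using hμ
  exact (ae_restrict_iff' measurableSet_Icc).1 (measure_eq_zero_iff_ae_notMem.1 h3)

end Arcs

/-! ### Midpoints and widths of chords; the parabolic arc. -/

section Chords

open MeasureTheory Filter Topology

theorem IsBump.ae_chord {Y τ : ℝ → ℝ} {J : Set ℝ} {ξ₀ ℓ a b q : ℝ} (hJ : IsOpen J)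
    (hY : ContDiffOn ℝ 2 Y J) (hT : ∀ ξ, HasConstantPeriod (lineGap Y ξ) J (τ ξ))
    (h : IsBump (lineGap Y ξ₀) J ℓ a b) (hℓ : 0 ≤ ℓ) (hq : q ∈ Icc a b) :
    ∀ᵐ μ : ℝ, μ ∈ Ioo ℓ (lineGap Y ξ₀ q) → ∃ c d, a < c ∧ c < q ∧ q < d ∧ d < b ∧
      lineGap Y ξ₀ c = μ ∧ lineGap Y ξ₀ d = μ ∧
      HasDerivAt (fun ξ => ∫ x in a..b, max (lineGap Y ξ x - μ) 0) ((d ^ 2 - c ^ 2) / 2) ξ₀ ∧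
      HasDerivAt (fun ν => ∫ x in a..b, max (lineGap Y ξ₀ x - ν) 0) (-(d - c)) μ := by
  have hcont : ContinuousOn (lineGap Y ξ₀) (Icc a b) :=
    (hY.lineGap ξ₀).continuousOn.mono h.subset
  filter_upwards [ae_regular_value fun x hx => (hY.lineGap ξ₀).differentiableAt_of_isOpen hJ hx,
    ae_level_null hcont] with μ hreg hnull hμ
  obtain ⟨c, d, hb, hac, hcq, hqd, hdb, hsup⟩ :=
    h.exists_superlevel hℓ (hT ξ₀) hJ (hY.lineGap ξ₀) hq hμ.1 hμ.2 hreg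
  have hpos : ∀ x ∈ Icc a b, 0 < lineGap Y ξ₀ x - μ ↔ x ∈ Ioo c d := fun x hx =>
    ⟨fun h0 => hsup x hx (by linarith), fun h0 => by linarith [hb.above x h0]⟩
  have hnull' : ∀ᵐ x : ℝ, x ∈ Icc a b → lineGap Y ξ₀ x - μ ≠ 0 := by
    filter_upwards [hnull] with x hx hxI
    exact sub_ne_zero.2 (hx hxI)
  refine ⟨c, d, hac, hcq, hqd, hdb, hb.left, hb.right, ?_, ?_⟩
  · have h1 := hasDerivAt_integral_posPart (s₀ := ξ₀) (φ := fun x => x) hac.le hb.lt.le hdb.le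
      (hcont.sub continuousOn_const) continuous_id hpos hnull'
    rw [integral_id] at h1
    refine h1.congr_of_eventuallyEq (Eventually.of_forall fun ξ => ?_)
    refine intervalIntegral.integral_congr fun x _ => ?_
    simp only [lineGap, Pi.sub_apply]
    ring_nf
  · have h1 := hasDerivAt_integral_posPart (s₀ := μ) (φ := fun _ => -1) hac.le hb.lt.le hdb.le
      (hcont.sub continuousOn_const) continuous_const hpos hnull'
    rw [intervalIntegral.integral_const, smul_eq_mul, mul_neg_one] at h1
    refine h1.congr_of_eventuallyEq (Eventually.of_forall fun ν => ?_)
    refine intervalIntegral.integral_congr fun x _ => ?_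
    simp only [Pi.sub_apply]
    ring_nf

theorem rpow_two_thirds_mul_cube {A u : ℝ} (hA : 0 ≤ A) (hu : 0 ≤ u) :
    (A * √u ^ 3) ^ (2 / 3 : ℝ) = A ^ (2 / 3 : ℝ) * u := by
  rw [Real.mul_rpow hA (by positivity), ← Real.rpow_natCast, ← Real.rpow_mul (Real.sqrt_nonneg _)]
  norm_num
  left
  exact Real.sq_sqrt hu

/-- The midpoints of the chords of a given slope depend affinely on the level, and the widths are
proportional to the square root of the height. -/
theorem IsBump.chord_law {Y τ : ℝ → ℝ} {J : Set ℝ} {ξ₀ ℓ a b q : ℝ} (hJ : IsOpen J)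
    (hY : ContDiffOn ℝ 2 Y J) (hT : ∀ ξ, HasConstantPeriod (lineGap Y ξ) J (τ ξ))
    (h : IsBump (lineGap Y ξ₀) J ℓ a b) (hℓ : 0 ≤ ℓ) (hq : q ∈ Icc a b)
    (hmax : ∀ x ∈ Icc a b, lineGap Y ξ₀ x ≤ lineGap Y ξ₀ q) (hℓq : ℓ < lineGap Y ξ₀ q) :
    ∃ B p r : ℝ, 0 < B ∧ ∀ᵐ μ : ℝ, μ ∈ Ioo ℓ (lineGap Y ξ₀ q) → ∃ c d, a < c ∧ c < q ∧ q < d ∧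
      d < b ∧ lineGap Y ξ₀ c = μ ∧ lineGap Y ξ₀ d = μ ∧ (c + d) / 2 = p + r * μ ∧
      (d - c) / 2 = B * √(lineGap Y ξ₀ q - μ) := by
  set M := lineGap Y ξ₀ q with hM
  set N : ℝ → ℝ := fun ξ => sSup (lineGap Y ξ '' Icc a b) with hN
  have hNM : N ξ₀ = M := by
    have : IsGreatest (lineGap Y ξ₀ '' Icc a b) M :=
      ⟨⟨q, hq, rfl⟩, by rintro _ ⟨x, hx, rfl⟩; exact hmax x hx⟩
    exact this.csSup_eq
  set G : ℝ → ℝ → ℝ := fun ξ μ => ∫ x in a..b, max (lineGap Y ξ x - μ) 0 with hG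
  set A : ℝ → ℝ := fun ξ => τ ξ * (2 / 3) / abelConst with hA
  have hκ := abelConst_pos
  have hτ0 := h.period_pos hℓ (hT ξ₀) hJ (hY.lineGap ξ₀)
  have hA0 : 0 < A ξ₀ := by simp only [hA]; positivity
  have hev : ∀ μ ∈ Ioo ℓ M, ∀ᶠ ξ in 𝓝 ξ₀,
      0 ≤ A ξ ∧ μ ≤ N ξ ∧ G ξ μ = A ξ * √(N ξ - μ) ^ 3 := fun μ hμ => by
    filter_upwards [h.eventually_area hJ hY hT hℓ hμ.1 (show μ < N ξ₀ by rw [hNM]; exact hμ.2)]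
      with ξ ⟨h1, h2, h3⟩
    refine ⟨by simp only [hA]; positivity, h2, ?_⟩
    have h4 : abelConst * G ξ μ = τ ξ * (2 / 3 * √(N ξ - μ) ^ 3) := h3
    simp only [hA]
    field_simp
    linarith
  have hG0 : ∀ μ ∈ Ioo ℓ M, G ξ₀ μ = A ξ₀ * √(M - μ) ^ 3 := fun μ hμ => by
    rw [← hNM]; exact (hev μ hμ).self_of_nhds.2.2
  set k : ℝ → ℝ := fun ξ => A ξ ^ (2 / 3 : ℝ) with hk
  have hk0 : 0 < k ξ₀ := Real.rpow_pos_of_pos hA0 _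
  -- The power 2/3 makes the area affine in the level, so two levels determine both coefficients.
  have hH : ∀ μ ∈ Ioo ℓ M, ∀ᶠ ξ in 𝓝 ξ₀, G ξ μ ^ (2 / 3 : ℝ) = k ξ * (N ξ - μ) := fun μ hμ => by
    filter_upwards [hev μ hμ] with ξ ⟨h1, h2, h3⟩
    rw [h3, rpow_two_thirds_mul_cube h1 (by linarith)]
  have hchord := h.ae_chord hJ hY hT hℓ hq
  have hGpos : ∀ μ ∈ Ioo ℓ M, 0 < G ξ₀ μ := fun μ hμ => by
    rw [hG0 μ hμ]
    have := Real.sqrt_pos.2 (sub_pos.2 hμ.2)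
    positivity
  obtain ⟨m, hm1, hm2⟩ := exists_between hℓq
  obtain ⟨μ₁, hμ₁, hc₁⟩ := exists_mem_Ioo_of_ae hchord hm1
  obtain ⟨μ₂, hμ₂, hc₂⟩ := exists_mem_Ioo_of_ae hchord hm2
  have hμ₁' : μ₁ ∈ Ioo ℓ M := ⟨hμ₁.1, hμ₁.2.trans hm2⟩
  have hμ₂' : μ₂ ∈ Ioo ℓ M := ⟨hm1.trans hμ₂.1, hμ₂.2⟩
  obtain ⟨c₁, d₁, -, -, -, -, -, -, hd₁, -⟩ := hc₁ hμ₁'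
  obtain ⟨c₂, d₂, -, -, -, -, -, -, hd₂, -⟩ := hc₂ hμ₂'
  have hD₁ := hd₁.rpow_const (p := (2 / 3 : ℝ)) (Or.inl (hGpos μ₁ hμ₁').ne')
  have hD₂ := hd₂.rpow_const (p := (2 / 3 : ℝ)) (Or.inl (hGpos μ₂ hμ₂').ne')
  have hlt : 0 < μ₂ - μ₁ := by linarith [hμ₁.2, hμ₂.1]
  -- No regularity of τ in ξ is assumed: differentiability of k and kN at ξ₀ is read off from the
  -- areas at μ₁ and μ₂.
  obtain ⟨β, hβ⟩ : ∃ β, HasDerivAt k β ξ₀ := by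
    refine ⟨_, ((hD₁.sub hD₂).div_const (μ₂ - μ₁)).congr_of_eventuallyEq ?_⟩
    filter_upwards [hH μ₁ hμ₁', hH μ₂ hμ₂'] with ξ h1 h2
    change k ξ = (G ξ μ₁ ^ (2 / 3 : ℝ) - G ξ μ₂ ^ (2 / 3 : ℝ)) / (μ₂ - μ₁)
    rw [h1, h2]
    field_simp
    ring
  obtain ⟨α, hα⟩ : ∃ α, HasDerivAt (fun ξ => k ξ * N ξ) α ξ₀ := by
    refine ⟨_, (hD₁.add (hβ.mul_const μ₁)).congr_of_eventuallyEq ?_⟩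
    filter_upwards [hH μ₁ hμ₁'] with ξ h1
    change k ξ * N ξ = G ξ μ₁ ^ (2 / 3 : ℝ) + k ξ * μ₁
    rw [h1]
    ring
  refine ⟨3 / 4 * A ξ₀, α / k ξ₀, -(β / k ξ₀), by positivity, ?_⟩
  filter_upwards [hchord] with μ hμ hμM
  obtain ⟨c, d, hac, hcq, hqd, hdb, hFc, hFd, hdξ, hdμ⟩ := hμ hμM
  refine ⟨c, d, hac, hcq, hqd, hdb, hFc, hFd, ?_⟩
  have hs : 0 < √(M - μ) := Real.sqrt_pos.2 (sub_pos.2 hμM.2)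
  have hwidth : d - c = 3 / 2 * A ξ₀ * √(M - μ) := by
    have h1 : HasDerivAt (fun ν => A ξ₀ * √(M - ν) ^ 3)
        (A ξ₀ * (3 * √(M - μ) ^ 2 * (-1 / (2 * √(M - μ))))) μ := by
      have := ((((hasDerivAt_id μ).const_sub M).sqrt (sub_pos.2 hμM.2).ne').pow 3).const_mul
        (A ξ₀)
      simpa using this
    have h2 : (fun ν => G ξ₀ ν) =ᶠ[𝓝 μ] fun ν => A ξ₀ * √(M - ν) ^ 3 := by
      filter_upwards [Ioo_mem_nhds hμM.1 hμM.2] with ν hν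
      exact hG0 ν hν
    have h3 := hdμ.unique (h1.congr_of_eventuallyEq h2)
    have h4 : A ξ₀ * (3 * √(M - μ) ^ 2 * (-1 / (2 * √(M - μ)))) = -(3 / 2 * A ξ₀ * √(M - μ)) := by
      field_simp
    linarith
  refine ⟨?_, by rw [hwidth]; ring⟩
  have hD := hdξ.rpow_const (p := (2 / 3 : ℝ)) (Or.inl (hGpos μ hμM).ne')
  have hD' : HasDerivAt (fun ξ => G ξ μ ^ (2 / 3 : ℝ)) (α - β * μ) ξ₀ := by
    refine (hα.sub (hβ.mul_const μ)).congr_of_eventuallyEq ?_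
    filter_upwards [hH μ hμM] with ξ h1
    rw [h1]
    change _ = k ξ * N ξ - k ξ * μ
    ring
  have hsq : √(M - μ) ^ 2 = M - μ := Real.sq_sqrt (sub_pos.2 hμM.2).le
  have h1 := hD.unique hD'
  have h2 : G ξ₀ μ ^ ((2 / 3 : ℝ) - 1) * G ξ₀ μ = k ξ₀ * √(M - μ) ^ 2 := by
    rw [hsq]
    have := (hH μ hμM).self_of_nhds
    rw [hNM] at this
    rw [← this, Real.rpow_sub_one (hGpos μ hμM).ne', div_mul_cancel₀ _ (hGpos μ hμM).ne']
  -- The two slope derivatives of G^(2/3) are equated; dividing by the width then leaves the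
  -- midpoint.
  have h3 : (d ^ 2 - c ^ 2) / 2 * (2 / 3) * (k ξ₀ * √(M - μ) ^ 2) = (α - β * μ) * G ξ₀ μ := by
    rw [← h1, ← h2]
    ring
  rw [hG0 μ hμM] at h3
  have h4 : (d ^ 2 - c ^ 2) = (d - c) * (c + d) := by ring
  rw [h4, hwidth] at h3
  have h5 : (c + d) / 2 * k ξ₀ = α - β * μ := by
    have h6 : A ξ₀ * √(M - μ) ^ 3 ≠ 0 := by positivity
    apply mul_right_cancel₀ h6
    rw [← h3]
    ring
  field_simp
  linarith

/-- Over the radial range of an orbit the curve is an arc of a parabola. -/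
theorem IsBump.parabolic_arc {Y τ : ℝ → ℝ} {J : Set ℝ} {ξ₀ ℓ a b : ℝ} (hJ : IsOpen J)
    (hY : ContDiffOn ℝ 2 Y J) (hT : ∀ ξ, HasConstantPeriod (lineGap Y ξ) J (τ ξ))
    (h : IsBump (lineGap Y ξ₀) J ℓ a b) (hℓ : 0 ≤ ℓ) :
    ∃ B p r M t₀ : ℝ, 0 < B ∧ 0 < t₀ ∧
      (∀ t ∈ Icc (-t₀) t₀, p + r * (M - t ^ 2) + B * t ∈ Icc a b ∧
        lineGap Y ξ₀ (p + r * (M - t ^ 2) + B * t) = M - t ^ 2) ∧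
      ∀ x ∈ Icc a b, ∃ t ∈ Icc (-t₀) t₀, p + r * (M - t ^ 2) + B * t = x := by
  have hcont : ContinuousOn (lineGap Y ξ₀) (Icc a b) :=
    (hY.lineGap ξ₀).continuousOn.mono h.subset
  obtain ⟨q, hq, hmax⟩ := isCompact_Icc.exists_isMaxOn (nonempty_Icc.2 h.lt.le) hcont
  have hℓq : ℓ < lineGap Y ξ₀ q := by
    obtain ⟨m, hm⟩ := exists_between h.lt
    exact (h.above m hm).trans_le (hmax (Ioo_subset_Icc_self hm))
  obtain ⟨B, p, r, hB, hlaw⟩ := h.chord_law hJ hY hT hℓ hq (fun x hx => hmax hx) hℓq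
  set M := lineGap Y ξ₀ q with hM
  have haq : a < q := lt_of_le_of_ne hq.1 (by rintro rfl; linarith [h.left])
  have hqb : q < b := lt_of_le_of_ne hq.2 (by rintro rfl; linarith [h.right])
  have hends : ∀ μ ∈ Icc ℓ M,
      (p + r * μ - B * √(M - μ) ∈ Icc a q ∧ lineGap Y ξ₀ (p + r * μ - B * √(M - μ)) = μ) ∧
      (p + r * μ + B * √(M - μ) ∈ Icc q b ∧ lineGap Y ξ₀ (p + r * μ + B * √(M - μ)) = μ) := by
    intro μ hμ
    -- The almost everywhere law holds on a dense set of levels and passes to all of [ℓ, M] by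
    -- continuity.
    have hdense := Measure.dense_of_ae hlaw
    have hcl : μ ∈ closure (Ioo ℓ M ∩ {μ | μ ∈ Ioo ℓ M → ∃ c d, a < c ∧ c < q ∧ q < d ∧
        d < b ∧ lineGap Y ξ₀ c = μ ∧ lineGap Y ξ₀ d = μ ∧ (c + d) / 2 = p + r * μ ∧
        (d - c) / 2 = B * √(M - μ)}) := by
      rw [← closure_Ioo hℓq.ne] at hμ
      exact closure_minimal (hdense.open_subset_closure_inter isOpen_Ioo) isClosed_closure hμ
    obtain ⟨u, hu, hulim⟩ := mem_closure_iff_seq_limit.1 hcl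
    have hgood : ∀ n, (p + r * u n - B * √(M - u n) ∈ Icc a q ∧
        lineGap Y ξ₀ (p + r * u n - B * √(M - u n)) = u n) ∧
        (p + r * u n + B * √(M - u n) ∈ Icc q b ∧
        lineGap Y ξ₀ (p + r * u n + B * √(M - u n)) = u n) := fun n => by
      obtain ⟨c, d, h1, h2, h3, h4, h5, h6, h7, h8⟩ := (hu n).2 (hu n).1
      have e1 : p + r * u n - B * √(M - u n) = c := by linarith
      have e2 : p + r * u n + B * √(M - u n) = d := by linarith
      rw [e1, e2]
      exact ⟨⟨⟨h1.le, h2.le⟩, h5⟩, ⟨h3.le, h4.le⟩, h6⟩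
    have key : ∀ (X : ℝ → ℝ) (s e : ℝ), Continuous X → Icc s e ⊆ Icc a b →
        (∀ n, X (u n) ∈ Icc s e ∧ lineGap Y ξ₀ (X (u n)) = u n) →
        X μ ∈ Icc s e ∧ lineGap Y ξ₀ (X μ) = μ := fun X s e hX hse hn => by
      have hlim : Tendsto (fun n => X (u n)) atTop (𝓝 (X μ)) := (hX.tendsto μ).comp hulim
      have hmem : X μ ∈ Icc s e :=
        isClosed_Icc.mem_of_tendsto hlim (Eventually.of_forall fun n => (hn n).1)
      refine ⟨hmem, ?_⟩
      have h1 : Tendsto (fun n => lineGap Y ξ₀ (X (u n))) atTop (𝓝 (lineGap Y ξ₀ (X μ))) :=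
        (hcont (X μ) (hse hmem)).tendsto.comp (tendsto_nhdsWithin_iff.2
          ⟨hlim, Eventually.of_forall fun n => hse (hn n).1⟩)
      simp only [fun n => (hn n).2] at h1
      exact tendsto_nhds_unique h1 hulim
    exact ⟨key (fun μ => p + r * μ - B * √(M - μ)) a q (by fun_prop) (Icc_subset_Icc_right hq.2)
        (fun n => (hgood n).1),
      key (fun μ => p + r * μ + B * √(M - μ)) q b (by fun_prop) (Icc_subset_Icc_left hq.1)
        (fun n => (hgood n).2)⟩
  have ht0 : 0 < √(M - ℓ) := Real.sqrt_pos.2 (sub_pos.2 hℓq)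
  have hsq0 : √(M - ℓ) ^ 2 = M - ℓ := Real.sq_sqrt (sub_pos.2 hℓq).le
  have hpar : ∀ t ∈ Icc (-√(M - ℓ)) √(M - ℓ), p + r * (M - t ^ 2) + B * t ∈ Icc a b ∧
      lineGap Y ξ₀ (p + r * (M - t ^ 2) + B * t) = M - t ^ 2 := fun t ht => by
    have htsq : t ^ 2 ≤ M - ℓ := by
      rw [← hsq0]
      exact sq_le_sq' (by linarith [ht.1]) ht.2
    have hs : √(M - (M - t ^ 2)) = |t| := by rw [sub_sub_cancel, Real.sqrt_sq_eq_abs]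
    have h1 := hends (M - t ^ 2) ⟨by linarith, by nlinarith [sq_nonneg t]⟩
    rw [hs] at h1
    rcases le_total t 0 with h0 | h0
    · rw [abs_of_nonpos h0] at h1
      have h2 := h1.1
      rw [mul_neg, sub_neg_eq_add] at h2
      exact ⟨⟨h2.1.1, h2.1.2.trans hq.2⟩, h2.2⟩
    · rw [abs_of_nonneg h0] at h1
      exact ⟨⟨hq.1.trans h1.2.1.1, h1.2.1.2⟩, h1.2.2⟩
  refine ⟨B, p, r, M, √(M - ℓ), hB, ht0, hpar, fun x hx => ?_⟩
  have hX : Continuous fun t : ℝ => p + r * (M - t ^ 2) + B * t := by fun_prop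
  -- The limiting chord end has gap ℓ and lies in [a, q]; only `a` does. With the right end, the
  -- intermediate value theorem makes the parametrization cover [a, b].
  have hleft : p + r * (M - (-√(M - ℓ)) ^ 2) + B * (-√(M - ℓ)) = a := by
    have h1 := (hends ℓ ⟨le_rfl, hℓq.le⟩).1
    have e : p + r * (M - (-√(M - ℓ)) ^ 2) + B * (-√(M - ℓ)) = p + r * ℓ - B * √(M - ℓ) := by
      rw [neg_sq, hsq0]; ring
    rw [e]
    by_contra hne
    have := h.above _ ⟨lt_of_le_of_ne h1.1.1 (Ne.symm hne), h1.1.2.trans_lt hqb⟩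
    linarith [h1.2]
  have hright : p + r * (M - √(M - ℓ) ^ 2) + B * √(M - ℓ) = b := by
    have h1 := (hends ℓ ⟨le_rfl, hℓq.le⟩).2
    have e : p + r * (M - √(M - ℓ) ^ 2) + B * √(M - ℓ) = p + r * ℓ + B * √(M - ℓ) := by
      rw [hsq0]; ring
    rw [e]
    by_contra hne
    have := h.above _ ⟨haq.trans_le h1.1.1, lt_of_le_of_ne h1.1.2 hne⟩
    linarith [h1.2]
  have hivt := intermediate_value_Icc (by linarith : -√(M - ℓ) ≤ √(M - ℓ)) hX.continuousOn
  simp only [hleft, hright] at hivt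
  exact hivt hx

end Chords

/-! ### Rotating chords and gluing the arcs. -/

section Extension

open MeasureTheory Filter Topology

theorem IsBump.deriv_right_neg {F : ℝ → ℝ} {S : Set ℝ} {μ c d : ℝ} (h : IsBump F S μ c d)
    (hS : IsOpen S) (hF : ContDiffOn ℝ 2 F S) : deriv F d < 0 := by
  have := h.reflect.deriv_left_pos hS.reflect hF.reflect
  simpa [deriv_comp_neg_at] using this

theorem deriv_nonpos_of_above {F : ℝ → ℝ} {c d : ℝ} (hcd : c < d) (hF : DifferentiableAt ℝ F d)
    (h : ∀ x ∈ Ioo c d, F d ≤ F x) : deriv F d ≤ 0 := by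
  have h1 := deriv_nonneg_of_above (F := fun x => F (-x)) (c := -d) (d := -c) (by linarith)
    (DifferentiableAt.comp (-d) (by simpa using hF) differentiable_neg.differentiableAt)
    (fun x hx => by simpa using h (-x) ⟨by linarith [hx.2], by linarith [hx.1]⟩)
  simpa [deriv_comp_neg_at] using h1

theorem deriv_lineGap {Y : ℝ → ℝ} {x : ℝ} (hY : DifferentiableAt ℝ Y x) (ξ : ℝ) :
    deriv (lineGap Y ξ) x = ξ - deriv Y x := by
  have : HasDerivAt (lineGap Y ξ) (ξ - deriv Y x) x := by
    exact (((hasDerivAt_id x).const_mul ξ).sub hY.hasDerivAt).congr_deriv (by simp)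
  exact this.deriv

/-- Rotating a chord upwards about its left end point produces chords of all larger widths. -/
theorem IsBump.rotate_left_fixed {Y τ : ℝ → ℝ} {J : Set ℝ} {ξ ℓ a b b' : ℝ} (hJ : IsOpen J)
    (hJc : J.OrdConnected) (hY : ContDiffOn ℝ 2 Y J)
    (hT : ∀ ξ, HasConstantPeriod (lineGap Y ξ) J (τ ξ))
    (h : IsBump (lineGap Y ξ) J ℓ a b) (hb' : b' ∈ J) (hbb' : b < b')
    (hpos : ∀ x ∈ Icc b b', ξ < (Y x - Y a) / (x - a) → 0 ≤ lineGap Y ((Y x - Y a) / (x - a)) a) :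
    ∃ ξ' ℓ', 0 ≤ ℓ' ∧ IsBump (lineGap Y ξ') J ℓ' a b' := by
  have hab := h.lt
  have haJ : a ∈ J := h.subset (left_mem_Icc.2 hab.le)
  have hbJ : b ∈ J := h.subset (right_mem_Icc.2 hab.le)
  have hJ' : Icc a b' ⊆ J := hJc.out haJ hb'
  have hdiff : ∀ x ∈ J, DifferentiableAt ℝ Y x := fun x hx => hY.differentiableAt_of_isOpen hJ hx
  set g : ℝ → ℝ := fun x => (Y x - Y a) / (x - a) with hg
  have hgx : ∀ x, a < x → g x * (x - a) = Y x - Y a := fun x hx =>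
    div_mul_cancel₀ _ (sub_pos.2 hx).ne'
  have hgb : g b = ξ := by
    have h1 := h.left.trans h.right.symm
    simp only [lineGap] at h1
    simp only [hg]
    rw [div_eq_iff (sub_pos.2 hab).ne']
    linarith
  have hder : ∀ x ∈ Icc b b', HasDerivAt g ((deriv Y x - g x) / (x - a)) x := fun x hx => by
    have hxa : 0 < x - a := by linarith [hx.1]
    have h1 := ((hdiff x (hJ' ⟨hab.le.trans hx.1, hx.2⟩)).hasDerivAt.sub_const (Y a)).div
      ((hasDerivAt_id x).sub_const a) hxa.ne'
    refine h1.congr_deriv ?_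
    have := hgx x (by linarith)
    simp only [id, ← this]
    field_simp
  have hcontg : ContinuousOn g (Icc b b') := fun x hx => (hder x hx).continuousAt.continuousWithinAt
  have hmono : ∀ x₁ ∈ Icc b b', (∀ x ∈ Ico b x₁, g x < deriv Y x) →
      StrictMonoOn g (Icc b x₁) := fun x₁ hx₁ hlt => by
    refine strictMonoOn_of_deriv_pos (convex_Icc _ _)
      (hcontg.mono (Icc_subset_Icc_right hx₁.2)) fun x hx => ?_
    rw [interior_Icc] at hx
    rw [(hder x ⟨hx.1.le, hx.2.le.trans hx₁.2⟩).deriv]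
    exact div_pos (sub_pos.2 (hlt x ⟨hx.1.le, hx.2⟩)) (by linarith [hx.1])
  have hright : ∀ x₁ ∈ Icc b b', lineGap Y (g x₁) x₁ = lineGap Y (g x₁) a := fun x₁ hx₁ => by
    have := hgx x₁ (by linarith [hx₁.1])
    simp only [lineGap]
    linarith
  have habove : ∀ x₁ ∈ Icc b b', b < x₁ → StrictMonoOn g (Icc b x₁) →
      ∀ x ∈ Ioo a x₁, lineGap Y (g x₁) a < lineGap Y (g x₁) x := fun x₁ hx₁ hbx hm x hx => by
    have h1 : g x < g x₁ := by
      rcases lt_or_ge x b with hxb | hxb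
      · have h2 : g b < g x₁ := hm ⟨le_rfl, hbx.le⟩ ⟨hbx.le, le_rfl⟩ hbx
        have h3 := h.above x ⟨hx.1, hxb⟩
        rw [← h.left] at h3
        simp only [lineGap] at h3
        have h4 : g x < ξ := by
          simp only [hg]
          rw [div_lt_iff₀ (sub_pos.2 hx.1)]
          linarith
        linarith
      · exact hm ⟨hxb, hx.2.le⟩ ⟨hbx.le, le_rfl⟩ hx.2
    have h5 := hgx x hx.1
    have h6 := mul_lt_mul_of_pos_right h1 (sub_pos.2 hx.1)
    simp only [lineGap]
    linarith
  -- At the first failure x₁ the chord from `a` still lies strictly above the curve in between, so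
  -- it would be tangent at x₁, against `not_critical_right`.
  have hsteep : ∀ x ∈ Icc b b', g x < deriv Y x := by
    by_contra hcon
    push Not at hcon
    obtain ⟨x₀, hx₀, hx₀'⟩ := hcon
    have hK : IsCompact {x ∈ Icc b b' | deriv Y x - g x ≤ 0} := by
      refine isCompact_Icc.of_isClosed_subset ?_ (fun x hx => hx.1)
      refine ContinuousOn.preimage_isClosed_of_isClosed ?_ isClosed_Icc
        (isClosed_Iic (a := (0 : ℝ)))
      exact ((hY.continuousOn_deriv_of_isOpen hJ (by norm_num)).mono
        ((Icc_subset_Icc_left hab.le).trans hJ')).sub hcontg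
    obtain ⟨x₁, ⟨hx₁, hx₁'⟩, hmin⟩ := hK.exists_isLeast ⟨x₀, hx₀, sub_nonpos.2 hx₀'⟩
    have hbx₁ : b < x₁ := by
      refine lt_of_le_of_ne hx₁.1 ?_
      rintro rfl
      have h1 := h.deriv_right_neg hJ (hY.lineGap ξ)
      rw [deriv_lineGap (hdiff _ hbJ)] at h1
      linarith
    have hm := hmono x₁ hx₁ fun x hx => by
      by_contra hcon
      exact absurd (hmin ⟨⟨hx.1, hx.2.le.trans hx₁.2⟩, by linarith⟩) (not_le.2 hx.2)
    have hab₁ := habove x₁ hx₁ hbx₁ hm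
    have hgt : ξ < g x₁ := hgb ▸ hm ⟨le_rfl, hbx₁.le⟩ ⟨hbx₁.le, le_rfl⟩ hbx₁
    have hx₁J : x₁ ∈ J := hJ' ⟨hab.le.trans hx₁.1, hx₁.2⟩
    refine (hT (g x₁)).not_critical_right hJ (hY.lineGap _)
      ((Icc_subset_Icc_right hx₁.2).trans hJ') (hab.trans hbx₁) rfl (hright x₁ hx₁)
      (hpos x₁ hx₁ hgt) hab₁ (le_antisymm ?_ ?_)
    · exact deriv_nonpos_of_above (hab.trans hbx₁)
        ((hY.lineGap _).differentiableAt_of_isOpen hJ hx₁J)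
        fun x hx => by rw [hright x₁ hx₁]; exact (hab₁ x hx).le
    · rw [deriv_lineGap (hdiff _ hx₁J)]
      linarith
  have hb'K : b' ∈ Icc b b' := ⟨hbb'.le, le_rfl⟩
  have hm := hmono b' hb'K fun x hx => hsteep x ⟨hx.1, hx.2.le⟩
  have hgt : ξ < g b' := hgb ▸ hm ⟨le_rfl, hbb'.le⟩ hb'K hbb'
  refine ⟨g b', lineGap Y (g b') a, hpos b' hb'K hgt, hab.trans hbb', hJ', rfl,
    hright b' hb'K, habove b' hb'K hbb' hm, ?_, ?_⟩
  · have h1 := h.deriv_left_pos hJ (hY.lineGap ξ)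
    rw [deriv_lineGap (hdiff _ haJ)] at h1 ⊢
    exact ne_of_gt (by linarith)
  · rw [deriv_lineGap (hdiff _ hb')]
    exact ne_of_lt (by linarith [hsteep b' hb'K])

/-- Since a > 0, a steeper line through the left end has a larger gap at `a`, so the level stays
nonnegative. -/
theorem IsBump.extend_right {Y τ : ℝ → ℝ} {J : Set ℝ} {ξ ℓ a b b' : ℝ} (hJ : IsOpen J)
    (hJc : J.OrdConnected) (hJ0 : J ⊆ Ioi 0) (hY : ContDiffOn ℝ 2 Y J)
    (hT : ∀ ξ, HasConstantPeriod (lineGap Y ξ) J (τ ξ)) (hℓ : 0 ≤ ℓ)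
    (h : IsBump (lineGap Y ξ) J ℓ a b) (hb' : b' ∈ J) (hbb' : b < b') :
    ∃ ξ' ℓ', 0 ≤ ℓ' ∧ IsBump (lineGap Y ξ') J ℓ' a b' := by
  refine h.rotate_left_fixed hJ hJc hY hT hb' hbb' fun x _ hlt => ?_
  have ha : 0 < a := hJ0 (h.subset (left_mem_Icc.2 h.lt.le))
  have h1 := h.left
  simp only [lineGap] at h1 ⊢
  linarith [mul_lt_mul_of_pos_right hlt ha]

/-- Reflection reduces this to rotation about a left end. The level of the chord from x to `b` is
(xY(b) − bY(x))/(b − x), which `hmono` keeps nonnegative. -/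
theorem IsBump.extend_left {Y τ : ℝ → ℝ} {J : Set ℝ} {ξ ℓ a b a' : ℝ} (hJ : IsOpen J)
    (hJc : J.OrdConnected) (hY : ContDiffOn ℝ 2 Y J)
    (hT : ∀ ξ, HasConstantPeriod (lineGap Y ξ) J (τ ξ))
    (h : IsBump (lineGap Y ξ) J ℓ a b) (ha' : a' ∈ J) (haa' : a' < a)
    (hmono : ∀ x ∈ J, x < b → b * Y x ≤ x * Y b) :
    ∃ ξ' ℓ', 0 ≤ ℓ' ∧ IsBump (lineGap Y ξ') J ℓ' a' b := by
  have hgap : ∀ ξ, lineGap (fun x => Y (-x)) ξ = fun x => lineGap Y (-ξ) (-x) := fun ξ => by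
    funext x
    simp only [lineGap]
    ring
  have hJc' : (Neg.neg ⁻¹' J).OrdConnected := by
    refine ⟨fun x hx y hy z hz => ?_⟩
    exact hJc.out hy hx ⟨neg_le_neg hz.2, neg_le_neg hz.1⟩
  have hpos : ∀ x ∈ Icc (-a) (-a'), -ξ < (Y (-x) - Y (-(-b))) / (x - -b) →
      0 ≤ lineGap (fun x => Y (-x)) ((Y (-x) - Y (-(-b))) / (x - -b)) (-b) := by
    intro x hx _
    have hxb : -x < b := by linarith [hx.1, h.lt]
    have h1 := hmono (-x) (hJc.out ha' (h.subset (left_mem_Icc.2 h.lt.le))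
      ⟨by linarith [hx.2], by linarith [hx.1]⟩) hxb
    simp only [lineGap, neg_neg, sub_neg_eq_add]
    have hpos : 0 < x + b := by linarith
    have e : (Y (-x) - Y b) / (x + b) * -b - Y b = ((-x) * Y b - b * Y (-x)) / (x + b) := by
      field_simp
      ring
    rw [e]
    exact div_nonneg (by linarith) hpos.le
  have hrefl : IsBump (lineGap (fun x => Y (-x)) (-ξ)) (Neg.neg ⁻¹' J) ℓ (-b) (-a) := by
    rw [hgap, neg_neg]
    exact h.reflect
  obtain ⟨ξ', ℓ', hℓ', hb⟩ := hrefl.rotate_left_fixed (τ := fun ξ => τ (-ξ)) (b' := -a')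
    hJ.reflect hJc' hY.reflect (fun ξ => by rw [hgap]; exact (hT (-ξ)).reflect)
    (by simpa using ha') (by linarith) hpos
  refine ⟨-ξ', ℓ', hℓ', ?_⟩
  rw [hgap] at hb
  have := hb.reflect
  simpa [preimage_preimage] using this

theorem quartic_coeff_eq_zero {c₀ c₁ c₂ c₃ c₄ s : ℝ} (hs : 0 < s)
    (h : ∀ t ∈ Icc (-(2 * s)) (2 * s), c₄ * t ^ 4 + c₃ * t ^ 3 + c₂ * t ^ 2 + c₁ * t + c₀ = 0) :
    c₄ = 0 ∧ c₂ = 0 ∧ c₁ = 0 ∧ c₀ = 0 := by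
  have e0 := h 0 ⟨by linarith, by linarith⟩
  have e1 := h s ⟨by linarith, by linarith⟩
  have e2 := h (-s) ⟨by linarith, by linarith⟩
  have e3 := h (2 * s) ⟨by linarith, by linarith⟩
  have e4 := h (-(2 * s)) ⟨by linarith, by linarith⟩
  have k0 : c₀ = 0 := by linarith
  have k4 : c₄ * s ^ 4 = 0 := by linarith
  have k4' : c₄ = 0 := (mul_eq_zero.1 k4).resolve_right (by positivity)
  have k2 : c₂ * s ^ 2 = 0 := by linarith
  have k1 : c₁ * s = 0 := by linarith
  exact ⟨k4', (mul_eq_zero.1 k2).resolve_right (by positivity),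
    (mul_eq_zero.1 k1).resolve_right hs.ne', k0⟩

/-- The curve over the radial range of an orbit lies on a parabola, and this parabola is determined
by the arc. -/
theorem IsBump.exists_parabola {Y τ : ℝ → ℝ} {J : Set ℝ} {ξ ℓ a b : ℝ} (hJ : IsOpen J)
    (hY : ContDiffOn ℝ 2 Y J) (hT : ∀ ξ, HasConstantPeriod (lineGap Y ξ) J (τ ξ))
    (h : IsBump (lineGap Y ξ) J ℓ a b) (hℓ : 0 ≤ ℓ) :
    ∃ a₁ b₁ c₁ d₁ e₁ : ℝ, a₁ * d₁ - b₁ * c₁ ≠ 0 ∧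
      (∀ x ∈ Icc a b, (a₁ * x + b₁ * Y x) ^ 2 + c₁ * x + d₁ * Y x + e₁ = 0) ∧
      ∀ a₂ b₂ c₂ d₂ e₂ : ℝ, a₂ * d₂ - b₂ * c₂ ≠ 0 →
        (∀ x ∈ Icc a b, (a₂ * x + b₂ * Y x) ^ 2 + c₂ * x + d₂ * Y x + e₂ = 0) →
        ∀ x y : ℝ, (a₂ * x + b₂ * y) ^ 2 + c₂ * x + d₂ * y + e₂ = 0 →
          (a₁ * x + b₁ * y) ^ 2 + c₁ * x + d₁ * y + e₁ = 0 := by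
  obtain ⟨B, p, r, M, t₀, hB, ht₀, hpar, hsurj⟩ := h.parabolic_arc hJ hY hT hℓ
  -- Eliminating t: with gap = ξx − y = M − t² and u = x − p − r·gap = Bt, the equation is u² = B²(M
  -- − gap).
  have hQ : ∀ x y : ℝ, ((1 - r * ξ) * x + r * y) ^ 2 + (B ^ 2 * ξ - 2 * p * (1 - r * ξ)) * x +
      (-B ^ 2 - 2 * p * r) * y + (p ^ 2 - B ^ 2 * M) =
      (x - p - r * (ξ * x - y)) ^ 2 - B ^ 2 * (M - (ξ * x - y)) := fun x y => by ring
  refine ⟨1 - r * ξ, r, B ^ 2 * ξ - 2 * p * (1 - r * ξ), -B ^ 2 - 2 * p * r, p ^ 2 - B ^ 2 * M,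
    ?_, fun x hx => ?_, fun a₂ b₂ c₂ d₂ e₂ hne hvan x y hxy => ?_⟩
  · have : (1 - r * ξ) * (-B ^ 2 - 2 * p * r) - r * (B ^ 2 * ξ - 2 * p * (1 - r * ξ)) = -B ^ 2 := by
      ring
    rw [this]
    exact (neg_neg_of_pos (by positivity)).ne
  · obtain ⟨t, ht, rfl⟩ := hsurj x hx
    have h1 := (hpar t ht).2
    rw [hQ]
    simp only [lineGap] at h1
    rw [h1]
    ring
  -- Coefficients of the second equation in the affine coordinates u and v = M − gap: its linear
  -- form is gu + kv + l and the rest mu + nv + o. On the arc u = Bt and v = t², so a quartic in t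
  -- vanishes.
  · set g := a₂ + b₂ * ξ with hg
    set k := b₂ - r * g with hk
    set l := g * (p + r * M) - b₂ * M with hl
    set m := c₂ + d₂ * ξ with hm
    set n := d₂ - r * m with hn
    set o := m * (p + r * M) - d₂ * M + e₂ with ho
    have hquart := quartic_coeff_eq_zero (s := t₀ / 2) (c₀ := l ^ 2 + o)
      (c₁ := (2 * g * l + m) * B) (c₂ := g ^ 2 * B ^ 2 + 2 * k * l + n) (c₃ := 2 * g * k * B)
      (c₄ := k ^ 2) (by positivity) fun t ht => by
        have ht' : t ∈ Icc (-t₀) t₀ := ⟨by linarith [ht.1], by linarith [ht.2]⟩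
        have h1 := hpar t ht'
        have h2 := hvan _ h1.1
        have h3 : Y (p + r * (M - t ^ 2) + B * t) =
            ξ * (p + r * (M - t ^ 2) + B * t) - (M - t ^ 2) := by
          have := h1.2
          simp only [lineGap] at this
          linarith
        rw [h3] at h2
        rw [← h2]
        simp only [hk, hl, hn, ho, hg, hm]
        ring
    obtain ⟨k4, k2, k1, k0⟩ := hquart
    have hk0 : k = 0 := by simpa using k4
    have hm' : 2 * g * l + m = 0 := (mul_eq_zero.1 k1).resolve_right hB.ne'
    rw [hk0] at k2
    have hg0 : g ≠ 0 := fun h0 => by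
      have hb₂ : b₂ = 0 := by rw [hk, h0] at hk0; linarith
      have ha₂ : a₂ = 0 := by rw [hg, hb₂] at h0; linarith
      exact hne (by rw [ha₂, hb₂]; ring)
    have hid : (a₂ * x + b₂ * y) ^ 2 + c₂ * x + d₂ * y + e₂ =
        (g * (x - p - r * (ξ * x - y)) + k * (M - (ξ * x - y)) + l) ^ 2 +
          m * (x - p - r * (ξ * x - y)) + n * (M - (ξ * x - y)) + o := by
      simp only [hk, hl, hn, ho, hg, hm]
      ring
    rw [hid, hk0] at hxy
    rw [hQ]
    have hm2 : m = -(2 * g * l) := by linarith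
    have hn2 : n = -(g ^ 2 * B ^ 2) := by linarith
    have ho2 : o = -l ^ 2 := by linarith
    rw [hm2, hn2, ho2] at hxy
    -- With k = 0, the second equation is g² times the first.
    have hfin : g ^ 2 * ((x - p - r * (ξ * x - y)) ^ 2 - B ^ 2 * (M - (ξ * x - y))) = 0 := by
      rw [← hxy]; ring
    exact (mul_eq_zero.1 hfin).resolve_left (by positivity)

/-- All arcs lie on one parabola. -/
theorem exists_common_parabola {Y τ : ℝ → ℝ} {J : Set ℝ} (hJ : IsOpen J)
    (hJc : J.OrdConnected) (hJ0 : J ⊆ Ioi 0) (hY : ContDiffOn ℝ 2 Y J)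
    (hT : ∀ ξ, HasConstantPeriod (lineGap Y ξ) J (τ ξ)) :
    ∃ a₁ b₁ c₁ d₁ e₁ : ℝ, a₁ * d₁ - b₁ * c₁ ≠ 0 ∧
      ∀ ξ ℓ a b, 0 ≤ ℓ → IsBump (lineGap Y ξ) J ℓ a b → ∀ x ∈ Icc a b,
        (a₁ * x + b₁ * Y x) ^ 2 + c₁ * x + d₁ * Y x + e₁ = 0 := by
  by_cases hex : ∃ ξ ℓ a b, 0 ≤ ℓ ∧ IsBump (lineGap Y ξ) J ℓ a b
  swap
  · exact ⟨1, 0, 0, 1, 0, by norm_num, fun ξ ℓ a b hℓ h => (hex ⟨ξ, ℓ, a, b, hℓ, h⟩).elim⟩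
  obtain ⟨ξ₀, ℓ₀, a₀, b₀, hℓ₀, h₀⟩ := hex
  obtain ⟨a₁, b₁, c₁, d₁, e₁, hne, -, huniq⟩ := h₀.exists_parabola hJ hY hT hℓ₀
  refine ⟨a₁, b₁, c₁, d₁, e₁, hne, fun ξ ℓ a b hℓ h x hx => ?_⟩
  have hext : ∀ ξ ℓ a b, 0 ≤ ℓ → IsBump (lineGap Y ξ) J ℓ a b → ∀ b' ∈ J, b ≤ b' →
      ∃ ξ' ℓ', 0 ≤ ℓ' ∧ IsBump (lineGap Y ξ') J ℓ' a b' := fun ξ ℓ a b hℓ h b' hb' hbb' => by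
    rcases hbb'.eq_or_lt with rfl | hlt
    · exact ⟨ξ, ℓ, hℓ, h⟩
    · exact h.extend_right hJ hJc hJ0 hY hT hℓ hb' hlt
  have hmaxJ : max b b₀ ∈ J := by
    rcases max_choice b b₀ with hm | hm <;> rw [hm]
    · exact h.subset (right_mem_Icc.2 h.lt.le)
    · exact h₀.subset (right_mem_Icc.2 h₀.lt.le)
  -- Extending the range with the smaller left end to the larger right end covers both, using
  -- rightward extension only.
  obtain ⟨a', haa', haa₀, ξ', ℓ', hℓ', h'⟩ : ∃ a', a' ≤ a ∧ a' ≤ a₀ ∧ ∃ ξ' ℓ', 0 ≤ ℓ' ∧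
      IsBump (lineGap Y ξ') J ℓ' a' (max b b₀) := by
    rcases le_total a a₀ with hle | hle
    · exact ⟨a, le_rfl, hle, hext ξ ℓ a b hℓ h _ hmaxJ (le_max_left _ _)⟩
    · exact ⟨a₀, hle, le_rfl, hext ξ₀ ℓ₀ a₀ b₀ hℓ₀ h₀ _ hmaxJ (le_max_right _ _)⟩
  obtain ⟨a₂, b₂, c₂, d₂, e₂, hne₂, hvan, -⟩ := h'.exists_parabola hJ hY hT hℓ'
  exact huniq a₂ b₂ c₂ d₂ e₂ hne₂
    (fun z hz => hvan z ⟨haa₀.trans hz.1, hz.2.trans (le_max_right _ _)⟩) x (Y x)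
    (hvan x ⟨haa'.trans hx.1, hx.2.trans (le_max_left _ _)⟩)

end Extension

/-! ### Translation between orbits and bumps in Hénon's variables. -/

section Henon

open MeasureTheory Filter Topology

/-- Hénon's function `Y(x) = x ψ(√(x/2))`. -/
noncomputable def henonFun (ψ : ℝ → ℝ) (x : ℝ) : ℝ := x * ψ √(x / 2)

/-- The range of Hénon's variable `x = 2r²` for `r ∈ I`. -/
def henonDomain (I : Set ℝ) : Set ℝ := {x | 0 < x ∧ √(x / 2) ∈ I}

theorem sqrt_two_mul_sq_div_two {r : ℝ} (hr : 0 < r) : √(2 * r ^ 2 / 2) = r := by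
  rw [mul_div_cancel_left₀ _ two_ne_zero, Real.sqrt_sq hr.le]

theorem two_mul_sqrt_div_two_sq {x : ℝ} (hx : 0 < x) : 2 * √(x / 2) ^ 2 = x := by
  rw [Real.sq_sqrt (by positivity)]
  ring

theorem two_mul_sq_mem_henonDomain {I : Set ℝ} {r : ℝ} (hr : 0 < r) :
    2 * r ^ 2 ∈ henonDomain I ↔ r ∈ I := by
  simp only [henonDomain, mem_ofPred_eq, sqrt_two_mul_sq_div_two hr, and_iff_right_iff_imp]
  exact fun _ => by positivity

theorem henonFun_two_mul_sq (ψ : ℝ → ℝ) {r : ℝ} (hr : 0 < r) :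
    henonFun ψ (2 * r ^ 2) = 2 * r ^ 2 * ψ r := by
  rw [henonFun, sqrt_two_mul_sq_div_two hr]

theorem isOpen_henonDomain {I : Set ℝ} (hI : IsOpen I) : IsOpen (henonDomain I) :=
  isOpen_Ioi.inter (hI.preimage (by fun_prop : Continuous fun x : ℝ => √(x / 2)))

theorem ordConnected_henonDomain {I : Set ℝ} (hI : I.OrdConnected) :
    (henonDomain I).OrdConnected :=
  ⟨fun _ hx _ hy z hz => ⟨hx.1.trans_le hz.1, hI.out hx.2 hy.2
    ⟨Real.sqrt_le_sqrt (by linarith [hz.1]), Real.sqrt_le_sqrt (by linarith [hz.2])⟩⟩⟩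

theorem contDiffOn_henonFun {I : Set ℝ} {ψ : ℝ → ℝ} (hψ : ContDiffOn ℝ 2 ψ I) :
    ContDiffOn ℝ 2 (henonFun ψ) (henonDomain I) := by
  refine contDiffOn_id.mul (hψ.comp ?_ fun x hx => hx.2)
  refine ContDiffOn.sqrt (contDiffOn_id.div_const 2) fun x hx => ?_
  exact (half_pos hx.1).ne'

theorem lineGap_henonFun (ψ : ℝ → ℝ) (ξ Λ : ℝ) {r : ℝ} (hr : 0 < r) :
    lineGap (henonFun ψ) ξ (2 * r ^ 2) - Λ ^ 2 =
      2 * r ^ 2 * (ξ - effectivePotential ψ Λ r) := by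
  rw [lineGap, henonFun_two_mul_sq ψ hr, effectivePotential]
  field_simp
  ring

theorem lineGap_henonFun_eq_iff (ψ : ℝ → ℝ) (ξ Λ : ℝ) {r : ℝ} (hr : 0 < r) :
    lineGap (henonFun ψ) ξ (2 * r ^ 2) = Λ ^ 2 ↔ effectivePotential ψ Λ r = ξ := by
  have h := lineGap_henonFun ψ ξ Λ hr
  have h2 : 2 * r ^ 2 ≠ 0 := by positivity
  rw [← sub_eq_zero, h, mul_eq_zero, or_iff_right h2, sub_eq_zero, eq_comm]

theorem lt_lineGap_henonFun_iff (ψ : ℝ → ℝ) (ξ Λ : ℝ) {r : ℝ} (hr : 0 < r) :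
    Λ ^ 2 < lineGap (henonFun ψ) ξ (2 * r ^ 2) ↔ effectivePotential ψ Λ r < ξ := by
  have h := lineGap_henonFun ψ ξ Λ hr
  rw [← sub_pos, h, mul_pos_iff_of_pos_left (by positivity), sub_pos]

/-- Near r, ψ_e = ξ − (gap − Λ²)/(2r²). Where the numerator vanishes, differentiating the
denominator contributes nothing, so the two derivatives are nonzero multiples of each other. -/
theorem deriv_effectivePotential_ne_zero_iff {I : Set ℝ} {ψ : ℝ → ℝ} {ξ Λ r : ℝ} (hI : IsOpen I)
    (hψ : ContDiffOn ℝ 2 ψ I) (hrI : r ∈ I) (hr : 0 < r)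
    (h : lineGap (henonFun ψ) ξ (2 * r ^ 2) = Λ ^ 2) :
    deriv (effectivePotential ψ Λ) r ≠ 0 ↔ deriv (lineGap (henonFun ψ) ξ) (2 * r ^ 2) ≠ 0 := by
  set D := deriv (lineGap (henonFun ψ) ξ) (2 * r ^ 2) with hD
  have hx := (two_mul_sq_mem_henonDomain hr).2 hrI
  have h1 : HasDerivAt (lineGap (henonFun ψ) ξ) D (2 * r ^ 2) :=
    (((contDiffOn_henonFun hψ).lineGap ξ).differentiableAt_of_isOpen
      (isOpen_henonDomain hI) hx).hasDerivAt
  have h2 : HasDerivAt (fun s : ℝ => 2 * s ^ 2) (4 * r) r :=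
    (((hasDerivAt_id r).pow 2).const_mul 2).congr_deriv (by simp; ring)
  have h3 : HasDerivAt (fun s => lineGap (henonFun ψ) ξ (2 * s ^ 2) - Λ ^ 2) (D * (4 * r)) r :=
    (HasDerivAt.comp r h1 h2).sub_const _
  have h4 := (h3.div h2 (by positivity)).const_sub ξ
  have h5 : HasDerivAt (effectivePotential ψ Λ) (-(D * (4 * r) / (2 * r ^ 2))) r := by
    refine (h4.congr_of_eventuallyEq ?_).congr_deriv ?_
    · filter_upwards [lt_mem_nhds hr] with s hs
      simp only [Pi.div_apply]
      rw [lineGap_henonFun ψ ξ Λ hs, mul_div_cancel_left₀ _ (by positivity)]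
      ring
    · rw [h, sub_self]
      field_simp
      ring
  rw [h5.deriv]
  have hr' := hr.ne'
  refine not_congr ⟨fun h0 => ?_, fun h0 => by rw [h0]; simp⟩
  have : D * (4 * r) = 0 := by
    have := neg_eq_zero.1 h0
    exact (div_eq_zero_iff.1 this).resolve_right (by positivity)
  exact (mul_eq_zero.1 this).resolve_right (by positivity)

theorem two_mul_sq_lt {r s : ℝ} (hr : 0 < r) (h : r < s) : 2 * r ^ 2 < 2 * s ^ 2 := by
  have := pow_lt_pow_left₀ h hr.le two_ne_zero
  linarith

theorem two_mul_sq_le {r s : ℝ} (hr : 0 < r) (h : r ≤ s) : 2 * r ^ 2 ≤ 2 * s ^ 2 := by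
  have := pow_le_pow_left₀ hr.le h 2
  linarith

theorem lt_of_two_mul_sq_lt {r s : ℝ} (hs : 0 < s) (h : 2 * r ^ 2 < 2 * s ^ 2) : r < s :=
  lt_of_pow_lt_pow_left₀ 2 hs.le (by linarith)

theorem le_of_two_mul_sq_le {r s : ℝ} (hs : 0 < s) (h : 2 * r ^ 2 ≤ 2 * s ^ 2) : r ≤ s :=
  le_of_pow_le_pow_left₀ two_ne_zero hs.le (by linarith)

/-- Radial orbits are the transversal chords that lie above the curve in Hénon's plane. -/
theorem isRadialOrbit_iff_isBump {I : Set ℝ} {ψ : ℝ → ℝ} {ξ Λ rP rA : ℝ} (hI : IsOpen I)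
    (hψ : ContDiffOn ℝ 2 ψ I) (hP : 0 < rP) (hA : 0 < rA) (hΛ : 0 ≤ Λ) :
    IsRadialOrbit ψ I ξ Λ rP rA ↔
      IsBump (lineGap (henonFun ψ) ξ) (henonDomain I) (Λ ^ 2) (2 * rP ^ 2) (2 * rA ^ 2) := by
  constructor
  · intro h
    have hl := (lineGap_henonFun_eq_iff ψ ξ Λ hP).2 h.periapsis
    have hr := (lineGap_henonFun_eq_iff ψ ξ Λ hA).2 h.apoapsis
    refine ⟨two_mul_sq_lt hP h.noncircular, fun x hx => ?_, hl, hr, fun x hx => ?_,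
      (deriv_effectivePotential_ne_zero_iff hI hψ
        (h.mem_domain (left_mem_Icc.2 h.noncircular.le)) hP hl).1 h.turning_periapsis,
      (deriv_effectivePotential_ne_zero_iff hI hψ
        (h.mem_domain (right_mem_Icc.2 h.noncircular.le)) hA hr).1 h.turning_apoapsis⟩
    · have hx0 : 0 < x := lt_of_lt_of_le (by positivity) hx.1
      have hs : 0 < √(x / 2) := Real.sqrt_pos.2 (half_pos hx0)
      rw [← two_mul_sqrt_div_two_sq hx0] at hx ⊢
      exact (two_mul_sq_mem_henonDomain hs).2
        (h.mem_domain ⟨le_of_two_mul_sq_le hs hx.1, le_of_two_mul_sq_le hA hx.2⟩)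
    · have hx0 : 0 < x := lt_trans (by positivity) hx.1
      have hs : 0 < √(x / 2) := Real.sqrt_pos.2 (half_pos hx0)
      rw [← two_mul_sqrt_div_two_sq hx0] at hx ⊢
      exact (lt_lineGap_henonFun_iff ψ ξ Λ hs).2
        (h.below _ ⟨lt_of_two_mul_sq_lt hs hx.1, lt_of_two_mul_sq_lt hA hx.2⟩)
  · intro h
    have hlt : rP < rA := lt_of_two_mul_sq_lt hA h.lt
    have hmem : Icc rP rA ⊆ I := fun r hr => by
      have hr0 : 0 < r := hP.trans_le hr.1
      exact (two_mul_sq_mem_henonDomain hr0).1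
        (h.subset ⟨two_mul_sq_le hP hr.1, two_mul_sq_le hr0 hr.2⟩)
    refine ⟨hΛ, hlt, hmem, (lineGap_henonFun_eq_iff ψ ξ Λ hP).1 h.left,
      (lineGap_henonFun_eq_iff ψ ξ Λ hA).1 h.right, fun r hr => ?_,
      (deriv_effectivePotential_ne_zero_iff hI hψ
        (hmem (left_mem_Icc.2 hlt.le)) hP h.left).2 h.deriv_left,
      (deriv_effectivePotential_ne_zero_iff hI hψ
        (hmem (right_mem_Icc.2 hlt.le)) hA h.right).2 h.deriv_right⟩
    have hr0 : 0 < r := hP.trans hr.1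
    exact (lt_lineGap_henonFun_iff ψ ξ Λ hr0).1
      (h.above _ ⟨two_mul_sq_lt hP hr.1, two_mul_sq_lt hr0 hr.2⟩)

theorem image_two_mul_sq_Ioo {rP rA : ℝ} (hP : 0 < rP) (hA : 0 < rA) :
    (fun r : ℝ => 2 * r ^ 2) '' Ioo rP rA = Ioo (2 * rP ^ 2) (2 * rA ^ 2) := by
  ext x
  constructor
  · rintro ⟨r, hr, rfl⟩
    exact ⟨two_mul_sq_lt hP hr.1, two_mul_sq_lt (hP.trans hr.1) hr.2⟩
  · intro hx
    have hx0 : 0 < x := lt_trans (by positivity) hx.1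
    have hs : 0 < √(x / 2) := Real.sqrt_pos.2 (half_pos hx0)
    rw [← two_mul_sqrt_div_two_sq hx0] at hx
    exact ⟨√(x / 2), ⟨lt_of_two_mul_sq_lt hs hx.1, lt_of_two_mul_sq_lt hA hx.2⟩,
      two_mul_sqrt_div_two_sq hx0⟩

/-- Under x = 2r² the root becomes r√(2ξ − 2ψ − Λ²/r²), and its factor r cancels against dx = 4r dr.
-/
theorem integral_lineGap_henonFun (ψ : ℝ → ℝ) (ξ Λ : ℝ) {rP rA : ℝ} (hP : 0 < rP)
    (hlt : rP < rA) :
    ∫ x in (2 * rP ^ 2)..(2 * rA ^ 2), 1 / √(lineGap (henonFun ψ) ξ x - Λ ^ 2) =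
      2 * radialPeriod ψ ξ Λ rP rA := by
  have hA := hP.trans hlt
  rw [radialPeriod, intervalIntegral.integral_of_le (two_mul_sq_lt hP hlt).le,
    intervalIntegral.integral_of_le hlt.le, integral_Ioc_eq_integral_Ioo,
    integral_Ioc_eq_integral_Ioo, ← image_two_mul_sq_Ioo hP hA,
    integral_image_eq_integral_abs_deriv_smul (f' := fun r => 4 * r) measurableSet_Ioo,
    ← integral_const_mul, ← integral_const_mul]
  · refine setIntegral_congr_fun measurableSet_Ioo fun r hr => ?_
    have hr0 : 0 < r := hP.trans hr.1
    have e : 2 * r ^ 2 * (ξ - effectivePotential ψ Λ r) =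
        r ^ 2 * (2 * ξ - 2 * ψ r - Λ ^ 2 / r ^ 2) := by
      rw [effectivePotential]
      field_simp
      ring
    simp only [smul_eq_mul]
    rw [lineGap_henonFun ψ ξ Λ hr0, e, Real.sqrt_mul (by positivity), Real.sqrt_sq hr0.le,
      abs_of_pos (by positivity)]
    field_simp
    ring
  · intro r _
    exact ((((hasDerivAt_id r).pow 2).const_mul 2).congr_deriv (by simp; ring)).hasDerivWithinAt
  · intro r hr s hs hrs
    have hr0 : 0 < r := hP.trans hr.1
    have hs0 : 0 < s := hP.trans hs.1
    exact le_antisymm (le_of_two_mul_sq_le hs0 hrs.le) (le_of_two_mul_sq_le hr0 hrs.ge)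

theorem IsIsochrone.hasConstantPeriod {I : Set ℝ} {ψ : ℝ → ℝ} (hI : IsOpen I)
    (hψ : ContDiffOn ℝ 2 ψ I) (hiso : IsIsochrone ψ I) :
    ∃ τ : ℝ → ℝ, ∀ ξ, HasConstantPeriod (lineGap (henonFun ψ) ξ) (henonDomain I) (τ ξ) := by
  obtain ⟨T, hT⟩ := hiso
  refine ⟨fun ξ => 2 * T ξ, fun ξ ℓ c d hℓ h => ?_⟩
  have hc : 0 < c := (h.subset (left_mem_Icc.2 h.lt.le)).1
  have hd : 0 < d := (h.subset (right_mem_Icc.2 h.lt.le)).1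
  have hP : 0 < √(c / 2) := Real.sqrt_pos.2 (half_pos hc)
  have hA : 0 < √(d / 2) := Real.sqrt_pos.2 (half_pos hd)
  have horb : IsRadialOrbit ψ I ξ √ℓ √(c / 2) √(d / 2) := by
    rw [isRadialOrbit_iff_isBump hI hψ hP hA (Real.sqrt_nonneg _), Real.sq_sqrt hℓ,
      two_mul_sqrt_div_two_sq hc, two_mul_sqrt_div_two_sq hd]
    exact h
  have h1 := integral_lineGap_henonFun ψ ξ √ℓ hP horb.noncircular
  rw [Real.sq_sqrt hℓ, two_mul_sqrt_div_two_sq hc, two_mul_sqrt_div_two_sq hd] at h1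
  rw [h1, hT _ _ _ _ horb]

theorem mem_visitedRadii_iff {I : Set ℝ} {ψ : ℝ → ℝ} (hI : IsOpen I) (hI0 : I ⊆ Ioi 0)
    (hψ : ContDiffOn ℝ 2 ψ I) {r : ℝ} (hr : 0 < r) :
    r ∈ visitedRadii ψ I ↔ ∃ ξ ℓ a b : ℝ, 0 ≤ ℓ ∧
      IsBump (lineGap (henonFun ψ) ξ) (henonDomain I) ℓ a b ∧ 2 * r ^ 2 ∈ Icc a b := by
  constructor
  · rintro ⟨ξ, Λ, rP, rA, h, hmem⟩
    have hP : 0 < rP := hI0 (h.mem_domain (left_mem_Icc.2 h.noncircular.le))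
    exact ⟨ξ, Λ ^ 2, 2 * rP ^ 2, 2 * rA ^ 2, sq_nonneg _,
      (isRadialOrbit_iff_isBump hI hψ hP (hP.trans h.noncircular) h.momentum_nonneg).1 h,
      two_mul_sq_le hP hmem.1, two_mul_sq_le hr hmem.2⟩
  · rintro ⟨ξ, ℓ, a, b, hℓ, h, hmem⟩
    have ha : 0 < a := (h.subset (left_mem_Icc.2 h.lt.le)).1
    have hb : 0 < b := (h.subset (right_mem_Icc.2 h.lt.le)).1
    have hP : 0 < √(a / 2) := Real.sqrt_pos.2 (half_pos ha)
    have hA : 0 < √(b / 2) := Real.sqrt_pos.2 (half_pos hb)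
    refine ⟨ξ, √ℓ, √(a / 2), √(b / 2), ?_, ?_, ?_⟩
    · rw [isRadialOrbit_iff_isBump hI hψ hP hA (Real.sqrt_nonneg _), Real.sq_sqrt hℓ,
        two_mul_sqrt_div_two_sq ha, two_mul_sqrt_div_two_sq hb]
      exact h
    · refine le_of_two_mul_sq_le hr ?_
      rw [two_mul_sqrt_div_two_sq ha]
      exact hmem.1
    · refine le_of_two_mul_sq_le hA ?_
      rw [two_mul_sqrt_div_two_sq hb]
      exact hmem.2

theorem visitedRadii_subset (ψ : ℝ → ℝ) (I : Set ℝ) : visitedRadii ψ I ⊆ I := by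
  rintro r ⟨ξ, Λ, rP, rA, h, hmem⟩
  exact h.mem_domain hmem

end Henon

theorem mainTheorem1 (I : Set ℝ) (hI_open : IsOpen I) (hI_interval : I.OrdConnected)
    (hI_pos : I ⊆ Set.Ioi 0) (ψ : ℝ → ℝ) (hψ : ContDiffOn ℝ 2 ψ I) (hiso : IsIsochrone ψ I) :
    (∃ P : Set (ℝ × ℝ), IsParabola P ∧ henonCurve ψ (visitedRadii ψ I) ⊆ P) ∧
      (visitedRadii ψ I).OrdConnected ∧
      (MonotoneOn ψ I → (visitedRadii ψ I).Nonempty → visitedRadii ψ I = I) := by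
  obtain ⟨τ, hT⟩ := hiso.hasConstantPeriod hI_open hψ
  have hJ := isOpen_henonDomain hI_open
  have hJc := ordConnected_henonDomain hI_interval
  have hJ0 : henonDomain I ⊆ Ioi 0 := fun x hx => hx.1
  have hY := contDiffOn_henonFun hψ
  have hsub := visitedRadii_subset ψ I
  refine ⟨?_, ⟨fun r hr s hs z hz => ?_⟩, fun hmono hne => hsub.antisymm fun r hr => ?_⟩
  · obtain ⟨a₁, b₁, c₁, d₁, e₁, hne, hvan⟩ := exists_common_parabola hJ hJc hJ0 hY hT
    refine ⟨_, ⟨a₁, b₁, c₁, d₁, e₁, hne, rfl⟩, ?_⟩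
    rintro _ ⟨r, hr, rfl⟩
    have hr0 : 0 < r := hI_pos (hsub hr)
    obtain ⟨ξ, ℓ, a, b, hℓ, h, hmem⟩ := (mem_visitedRadii_iff hI_open hI_pos hψ hr0).1 hr
    have := hvan ξ ℓ a b hℓ h _ hmem
    rwa [henonFun_two_mul_sq ψ hr0] at this
  · have hr0 : 0 < r := hI_pos (hsub hr)
    have hz0 : 0 < z := hr0.trans_le hz.1
    obtain ⟨ξ, ℓ, a, b, hℓ, h, hmem⟩ := (mem_visitedRadii_iff hI_open hI_pos hψ hr0).1 hr
    rw [mem_visitedRadii_iff hI_open hI_pos hψ hz0]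
    have hza : a ≤ 2 * z ^ 2 := hmem.1.trans (two_mul_sq_le hr0 hz.1)
    rcases le_or_gt (2 * z ^ 2) b with hzb | hzb
    · exact ⟨ξ, ℓ, a, b, hℓ, h, hza, hzb⟩
    · have hzJ : 2 * z ^ 2 ∈ henonDomain I :=
        (two_mul_sq_mem_henonDomain hz0).2 (hI_interval.out (hsub hr) (hsub hs) hz)
      obtain ⟨ξ', ℓ', hℓ', h'⟩ := h.extend_right hJ hJc hJ0 hY hT hℓ hzJ hzb
      exact ⟨ξ', ℓ', a, _, hℓ', h', hza, le_rfl⟩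
  · obtain ⟨s, hs⟩ := hne
    have hr0 : 0 < r := hI_pos hr
    obtain ⟨ξ, ℓ, a, b, hℓ, h, -⟩ :=
      (mem_visitedRadii_iff hI_open hI_pos hψ (hI_pos (hsub hs))).1 hs
    rw [mem_visitedRadii_iff hI_open hI_pos hψ hr0]
    have hrJ : 2 * r ^ 2 ∈ henonDomain I := (two_mul_sq_mem_henonDomain hr0).2 hr
    rcases lt_or_ge (2 * r ^ 2) a with hra | hra
    · have hbJ := h.subset (right_mem_Icc.2 h.lt.le)
      obtain ⟨ξ', ℓ', hℓ', h'⟩ := h.extend_left hJ hJc hY hT hrJ hra fun x hx hxb => by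
        -- Monotonicity of ψ = Y/x, multiplied by bx, is the inequality required by `extend_left`.
        have h1 := hmono hx.2 hbJ.2 (Real.sqrt_le_sqrt (by linarith : x / 2 ≤ b / 2))
        have h2 := mul_le_mul_of_nonneg_left h1 (mul_pos hbJ.1 hx.1).le
        simp only [henonFun]
        linarith
      exact ⟨ξ', ℓ', _, b, hℓ', h', le_rfl, hra.le.trans h.lt.le⟩
    · rcases le_or_gt (2 * r ^ 2) b with hrb | hrb
      · exact ⟨ξ, ℓ, a, b, hℓ, h, hra, hrb⟩
      · obtain ⟨ξ', ℓ', hℓ', h'⟩ := h.extend_right hJ hJc hJ0 hY hT hℓ hrJ hrb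
        exact ⟨ξ', ℓ', a, _, hℓ', h', hra, le_rfl⟩
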